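/- Let $T\ge 1$ be an integer. For real numbers $a_1,\dots,a_T>0$ and $b_1,\dots,b_T$, extend both sequences $T$-periodically to all indices $n\ge 1$ and let $J_T=J_T(a,b)$ be the associated $T$-periodic Jacobi operator on $\ell^2(\mathbb{N};\mathbb{C})$, i.e. the bounded self-adjoint operator $$(J_Tu)_1=b_1u_1+a_1u_2,\qquad (J_Tu)_n=a_{n-1}u_{n-1}+b_nu_n+a_nu_{n+1}\quad(n\ge 2).$$ The essential spectrum $\sigma_{ess}(J_T)$ is the set of $z\in\mathbb{C}$ for which $J_T-z$ is not a Fredholm operator, and the absolutely continuous spectrum $\sigma_{a.c.}(J_T)$ is the spectrum of the restriction of $J_T$ to its absolutely continuous subspace, i.e. to the subspace of vectors whose spectral measure is absolutely continuous with respect to Lebesgue measure. Then for almost all parameters $(a_1,\dots,a_T,b_1,\dots,b_T)\in(\mathbb{R}^+)^T\times\mathbb{R}^T$ the essential spectrum $\sigma_{ess}(J_T)$ consists of $T$ distinct real intervals: there are real numbers $\alpha_1<\beta_1<\alpha_2<\beta_2<\dots<\alpha_T<\beta_T$ with $$\sigma_{ess}(J_T)=\bigcup_{i=1}^{T}[\alpha_i,\beta_i].$$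 Here "almost all" means: for all parameters in some open dense subset of $(\mathbb{R}^+)^T\times\mathbb{R}^T$ whose complement in $(\mathbb{R}^+)^T\times\mathbb{R}^T$ has Lebesgue measure zero. Moreover, $\sigma_{ess}(J_T)=\sigma_{a.c.}(J_T)$ for all parameters in $(\mathbb{R}^+)^T\times\mathbb{R}^T$. -/

import Mathlib

open MeasureTheory
open scoped ENNReal InnerProductSpace CompactlySupported

noncomputable section

namespace PeriodicJacobi

/-! ### Essential and absolutely continuous spectrum of a self-adjoint operator -/

section Operator

variable {H : Type*} [NormedAddCommGroup H] [InnerProductSpace ℂ H] [CompleteSpace H]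

/-- The essential spectrum of a bounded operator `A`: the set of `z ∈ ℂ` such that `A - z` is not
Fredholm. -/
def essentialSpectrum (A : H →L[ℂ] H) : Set ℂ :=
  {z | ¬ (A - z • ContinuousLinearMap.id ℂ H).IsFredholm}

/-- The positive linear functional `f ↦ ⟨ψ, f(A) ψ⟩` on compactly supported continuous real
functions, `f(A)` being given by the continuous functional calculus of the self-adjoint
operator `A`. -/
def spectralFunctional (A : H →L[ℂ] H) (ψ : H) : C_c(ℝ, ℝ) →ₚ[ℝ] ℝ :=
  PositiveLinearMap.mk₀
    { toFun := fun f => (⟪ψ, cfc (fun x : ℝ => f x) A ψ⟫_ℂ).re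
      map_add' := fun f g => by
        have h : cfc (fun x : ℝ => (f + g) x) A
            = cfc (fun x : ℝ => f x) A + cfc (fun x : ℝ => g x) A :=
          cfc_add (a := A) (fun x : ℝ => f x) (fun x : ℝ => g x)
            f.continuous.continuousOn g.continuous.continuousOn
        rw [h]
        simp
      map_smul' := fun c f => by
        have h : cfc (fun x : ℝ => (c • f) x) A = c • cfc (fun x : ℝ => f x) A :=
          cfc_const_mul c (fun x : ℝ => f x) A f.continuous.continuousOn
        rw [h, smul_apply, ← Complex.coe_smul, inner_smul_right]
        simp }
    (fun f hf => by
      have h : 0 ≤ cfc (fun x : ℝ => f x) A := cfc_nonneg (fun x _ => hf x)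
      rw [ContinuousLinearMap.nonneg_iff_isPositive] at h
      exact h.re_inner_nonneg_right ψ)

/-- The spectral measure `μ_ψ` of the self-adjoint operator `A` at the vector `ψ`: the regular
Borel measure on `ℝ` with `∫ f dμ_ψ = ⟨ψ, f(A) ψ⟩` for all `f ∈ C_c(ℝ)`. -/
def spectralMeasure (A : H →L[ℂ] H) (ψ : H) : Measure ℝ :=
  RealRMK.rieszMeasure (spectralFunctional A ψ)

instance (A : H →L[ℂ] H) (ψ : H) : (spectralMeasure A ψ).Regular :=
  RealRMK.regular_rieszMeasure _

theorem integral_spectralMeasure (A : H →L[ℂ] H) (ψ : H) (f : C_c(ℝ, ℝ)) :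
    ∫ x, f x ∂(spectralMeasure A ψ) = (⟪ψ, cfc (fun x : ℝ => f x) A ψ⟫_ℂ).re :=
  RealRMK.integral_rieszMeasure (spectralFunctional A ψ) f

theorem integrable_cc (μ : Measure ℝ) [IsFiniteMeasureOnCompacts μ] (f : C_c(ℝ, ℝ)) :
    Integrable (fun x => f x) μ :=
  f.continuous.integrable_of_hasCompactSupport f.hasCompactSupport

theorem isLocallyFiniteMeasure_add (μ ν : Measure ℝ) [IsFiniteMeasureOnCompacts μ]
    [IsFiniteMeasureOnCompacts ν] : IsLocallyFiniteMeasure (μ + ν) := by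
  have : IsFiniteMeasureOnCompacts (μ + ν) := ⟨fun K hK => by
    rw [Measure.add_apply]
    exact ENNReal.add_lt_top.mpr ⟨hK.measure_lt_top, hK.measure_lt_top⟩⟩
  exact isLocallyFiniteMeasure_of_isFiniteMeasureOnCompacts

theorem spectralMeasure_parallelogram (A : H →L[ℂ] H) (φ ψ : H) :
    spectralMeasure A (φ + ψ) + spectralMeasure A (φ - ψ) =
      (spectralMeasure A φ + spectralMeasure A φ) + (spectralMeasure A ψ + spectralMeasure A ψ) := by
  have h1 := isLocallyFiniteMeasure_add (spectralMeasure A φ) (spectralMeasure A φ)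
  have h2 := isLocallyFiniteMeasure_add (spectralMeasure A ψ) (spectralMeasure A ψ)
  have h3 := isLocallyFiniteMeasure_add (spectralMeasure A (φ + ψ)) (spectralMeasure A (φ - ψ))
  have h4 := isLocallyFiniteMeasure_add (spectralMeasure A φ + spectralMeasure A φ)
    (spectralMeasure A ψ + spectralMeasure A ψ)
  apply Measure.ext_of_integral_eq_on_compactlySupported
  intro f
  have i (χ : H) := integrable_cc (spectralMeasure A χ) f
  rw [integral_add_measure (i _) (i _),
    integral_add_measure ((i _).add_measure (i _)) ((i _).add_measure (i _)),
    integral_add_measure (i _) (i _), integral_add_measure (i _) (i _)]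
  simp only [integral_spectralMeasure, map_add, map_sub, inner_add_left, inner_add_right,
    inner_sub_left, inner_sub_right, Complex.add_re, Complex.sub_re]
  ring

theorem spectralMeasure_smul (A : H →L[ℂ] H) (c : ℂ) (ψ : H) :
    spectralMeasure A (c • ψ) = (‖c‖₊ ^ 2) • spectralMeasure A ψ := by
  apply Measure.ext_of_integral_eq_on_compactlySupported
  intro f
  rw [integral_smul_nnreal_measure]
  simp only [integral_spectralMeasure, map_smul, inner_smul_left, inner_smul_right, ← mul_assoc]
  rw [Complex.mul_conj']
  rw [← Complex.ofReal_pow, Complex.re_ofReal_mul]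
  simp [NNReal.smul_def]

theorem spectralMeasure_zero (A : H →L[ℂ] H) : spectralMeasure A 0 = 0 := by
  simpa using spectralMeasure_smul A 0 0

theorem cfc_sandwich (A : H →L[ℂ] H) (hA : IsSelfAdjoint A) (f : ℝ → ℝ) (hf : Continuous f) :
    cfc (fun x : ℝ => x * (f x * x)) A = A * (cfc f A * A) := by
  rw [cfc_mul (fun x : ℝ => x) (fun x : ℝ => f x * x) A continuousOn_id
    (hf.mul continuous_id).continuousOn,
    cfc_mul f (fun x : ℝ => x) A hf.continuousOn continuousOn_id, cfc_id' ℝ A]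

theorem spectralMeasure_apply (A : H →L[ℂ] H) (hA : IsSelfAdjoint A) (ψ : H) :
    spectralMeasure A (A ψ) ≪ spectralMeasure A ψ := by
  have hd : Continuous fun x : ℝ => Real.toNNReal (x ^ 2) := by fun_prop
  have key : spectralMeasure A (A ψ) =
      (spectralMeasure A ψ).withDensity (fun x => (Real.toNNReal (x ^ 2) : ℝ≥0∞)) := by
    have : IsLocallyFiniteMeasure
        ((spectralMeasure A ψ).withDensity (fun x => (Real.toNNReal (x ^ 2) : ℝ≥0∞))) :=
      IsLocallyFiniteMeasure.withDensity_coe hd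
    apply Measure.ext_of_integral_eq_on_compactlySupported
    intro f
    rw [integral_withDensity_eq_integral_smul hd.measurable]
    have hs : HasCompactSupport (fun x : ℝ => x ^ 2 * f x) :=
      HasCompactSupport.mul_left (f := fun x : ℝ => x ^ 2) (f' := fun x : ℝ => f x)
        f.hasCompactSupport
    have hc : Continuous (fun x : ℝ => x ^ 2 * f x) := (continuous_pow 2).mul f.continuous
    let g : C_c(ℝ, ℝ) :=
      { toFun := fun x => x ^ 2 * f x
        continuous_toFun := hc
        hasCompactSupport' := hs }
    have hg : ∀ x : ℝ, Real.toNNReal (x ^ 2) • f x = g x := fun x => by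
      rw [NNReal.smul_def, Real.coe_toNNReal _ (sq_nonneg x)]; rfl
    simp only [hg]
    rw [integral_spectralMeasure, integral_spectralMeasure]
    have h1 : cfc (fun x : ℝ => g x) A = A * (cfc (fun x : ℝ => f x) A * A) := by
      have e : (fun x : ℝ => g x) = fun x => x * (f x * x) := by
        funext x
        change x ^ 2 * f x = _
        ring
      rw [e]
      exact cfc_sandwich A hA (fun x : ℝ => f x) f.continuous
    rw [h1]
    have h2 := hA.isSymmetric ψ (cfc (fun x : ℝ => f x) A (A ψ))
    exact congrArg Complex.re h2
  rw [key]
  exact withDensity_absolutelyContinuous _ _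

/-- The absolutely continuous subspace of `A`: all vectors whose spectral measure is absolutely
continuous with respect to Lebesgue measure. -/
def acSubspace (A : H →L[ℂ] H) : Submodule ℂ H where
  carrier := {ψ | spectralMeasure A ψ ≪ (volume : Measure ℝ)}
  add_mem' := by
    intro φ ψ hφ hψ s hs
    have h := congrArg (fun μ : Measure ℝ => μ s) (spectralMeasure_parallelogram A φ ψ)
    simp only [Measure.add_apply, hφ hs, hψ hs, add_zero] at h
    exact (add_eq_zero.mp h).1
  zero_mem' := by
    change spectralMeasure A 0 ≪ _
    rw [spectralMeasure_zero]
    exact Measure.AbsolutelyContinuous.zero _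
  smul_mem' := by
    intro c ψ hψ
    change spectralMeasure A (c • ψ) ≪ _
    rw [spectralMeasure_smul]
    exact Measure.AbsolutelyContinuous.smul_left hψ _

theorem mapsTo_acSubspace (A : H →L[ℂ] H) (hA : IsSelfAdjoint A) :
    ∀ ψ ∈ acSubspace A, A ψ ∈ acSubspace A :=
  fun ψ hψ => (spectralMeasure_apply A hA ψ).trans hψ

/-- The absolutely continuous spectrum of a bounded self-adjoint operator `A`: the spectrum of the
restriction of `A` to its absolutely continuous subspace. -/
def acSpectrum (A : H →L[ℂ] H) (hA : IsSelfAdjoint A) : Set ℂ :=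
  spectrum ℂ (A.restrict (p := acSubspace A) (q := acSubspace A) (mapsTo_acSubspace A hA))

end Operator

/-! ### Periodic Jacobi matrices on `ℓ²(ℕ; ℂ)` -/

/-- The Hilbert space `ℓ²(ℕ; ℂ)`. -/
abbrev Ell2 : Type := lp (fun _ : ℕ => ℂ) 2

/-- The `T`-periodic extension to `ℕ` of `(c 0, …, c (T - 1))`. -/
def perExt {T : ℕ} [NeZero T] (c : Fin T → ℝ) (n : ℕ) : ℝ := c (Fin.ofNat T n)

/-- The formal action on sequences of the Jacobi matrix with diagonal `b 0, b 1, …` and off-diagonal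
`a 0, a 1, …` (rows and columns are numbered from `0`). -/
def jacobiFun (a b : ℕ → ℝ) (u : ℕ → ℂ) : ℕ → ℂ
  | 0 => b 0 * u 0 + a 0 * u 1
  | n + 1 => a n * u n + b (n + 1) * u (n + 1) + a (n + 1) * u (n + 2)

theorem exists_bound_perExt {T : ℕ} [NeZero T] (c : Fin T → ℝ) : ∃ C : ℝ, ∀ n, |perExt c n| ≤ C := by
  obtain ⟨C, hC⟩ := (Set.finite_range fun i => |c i|).bddAbove
  exact ⟨C, fun n => hC ⟨_, rfl⟩⟩

theorem memℓp_mul {a : ℕ → ℝ} {C : ℝ} (ha : ∀ n, |a n| ≤ C) {u : ℕ → ℂ} (hu : Memℓp u 2) :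
    Memℓp (fun n => (a n : ℂ) * u n) 2 := by
  refine (hu.const_smul (C : ℂ)).mono' fun n => ?_
  simp only [Pi.smul_apply, smul_eq_mul, norm_mul, Complex.norm_real, Real.norm_eq_abs]
  exact mul_le_mul_of_nonneg_right ((ha n).trans (le_abs_self C)) (norm_nonneg _)

theorem memℓp_two_iff (u : ℕ → ℂ) : Memℓp u 2 ↔ Summable fun n => ‖u n‖ ^ 2 := by
  rw [memℓp_gen_iff (by norm_num)]
  simp

theorem memℓp_succ {u : ℕ → ℂ} (hu : Memℓp u 2) : Memℓp (fun n => u (n + 1)) 2 := by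
  rw [memℓp_two_iff] at hu ⊢
  exact (summable_nat_add_iff 1).mpr hu

theorem memℓp_of_succ {u : ℕ → ℂ} (hu : Memℓp (fun n => u (n + 1)) 2) : Memℓp u 2 := by
  rw [memℓp_two_iff] at hu ⊢
  exact (summable_nat_add_iff 1).mp hu

theorem memℓp_jacobiFun {a b : ℕ → ℝ} {C D : ℝ} (ha : ∀ n, |a n| ≤ C) (hb : ∀ n, |b n| ≤ D)
    {u : ℕ → ℂ} (hu : Memℓp u 2) : Memℓp (jacobiFun a b u) 2 := by
  have hu1 : Memℓp (fun n => u (n + 1)) 2 := memℓp_succ hu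
  have hu2 : Memℓp (fun n => u (n + 2)) 2 := memℓp_succ (u := fun n => u (n + 1)) hu1
  have h1 : Memℓp (fun n => (a n : ℂ) * u n) 2 := memℓp_mul ha hu
  have h2 : Memℓp (fun n => (b (n + 1) : ℂ) * u (n + 1)) 2 :=
    memℓp_mul (a := fun n => b (n + 1)) (u := fun n => u (n + 1)) (fun n => hb (n + 1)) hu1
  have h3 : Memℓp (fun n => (a (n + 1) : ℂ) * u (n + 2)) 2 :=
    memℓp_mul (a := fun n => a (n + 1)) (u := fun n => u (n + 2)) (fun n => ha (n + 1)) hu2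
  have e : (fun n => jacobiFun a b u (n + 1)) =
      ((fun n => (a n : ℂ) * u n) + (fun n => (b (n + 1) : ℂ) * u (n + 1))) +
        (fun n => (a (n + 1) : ℂ) * u (n + 2)) := by
    funext n
    simp only [jacobiFun, Pi.add_apply]
  refine memℓp_of_succ (u := jacobiFun a b u) ?_
  rw [e]
  exact Memℓp.add (Memℓp.add h1 h2) h3

/-- The `T`-periodic Jacobi matrix with parameters `a, b`, as a linear map on `ℓ²(ℕ; ℂ)`. -/
def jacobiLinear {T : ℕ} [NeZero T] (a b : Fin T → ℝ) : Ell2 →ₗ[ℂ] Ell2 where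
  toFun u := ⟨jacobiFun (perExt a) (perExt b) u,
    memℓp_jacobiFun (exists_bound_perExt a).choose_spec (exists_bound_perExt b).choose_spec u.2⟩
  map_add' u v := by
    ext n
    change jacobiFun _ _ (u + v : Ell2) n = jacobiFun _ _ u n + jacobiFun _ _ v n
    cases n <;> simp [jacobiFun] <;> ring
  map_smul' c u := by
    ext n
    change jacobiFun _ _ (c • u : Ell2) n = c • jacobiFun _ _ u n
    cases n <;> simp [jacobiFun] <;> ring

theorem jacobiFun_wronskian (a b : ℕ → ℝ) (u v : ℕ → ℂ) (N : ℕ) :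
    ∑ n ∈ Finset.range (N + 1), ⟪jacobiFun a b u n, v n⟫_ℂ
      - ∑ n ∈ Finset.range (N + 1), ⟪u n, jacobiFun a b v n⟫_ℂ
      = (a N : ℂ) * (⟪u (N + 1), v N⟫_ℂ - ⟪u N, v (N + 1)⟫_ℂ) := by
  induction N with
  | zero => simp [jacobiFun]; ring
  | succ N ih =>
    rw [Finset.sum_range_succ, Finset.sum_range_succ _ (N + 1), add_sub_add_comm, ih]
    simp [jacobiFun]
    ring

theorem isSymmetric_jacobiLinear {T : ℕ} [NeZero T] (a b : Fin T → ℝ) :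
    (jacobiLinear a b).IsSymmetric := by
  intro u v
  have h1 := ((lp.hasSum_inner (𝕜 := ℂ) (G := fun _ : ℕ => ℂ) (jacobiLinear a b u) v).tendsto_sum_nat.sub
    (lp.hasSum_inner (𝕜 := ℂ) (G := fun _ : ℕ => ℂ) u (jacobiLinear a b v)).tendsto_sum_nat).comp (Filter.tendsto_add_atTop_nat 1)
  have h0 : ∀ w : Ell2, Filter.Tendsto (fun n => ‖w n‖) Filter.atTop (nhds 0) := fun w => by
    have h := ((memℓp_two_iff _).mp w.2).tendsto_atTop_zero.sqrt
    simpa using h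
  obtain ⟨C, hC⟩ := exists_bound_perExt a
  have h2 : Filter.Tendsto (fun N => (perExt a N : ℂ) *
      (⟪u (N + 1), v N⟫_ℂ - ⟪u N, v (N + 1)⟫_ℂ)) Filter.atTop (nhds 0) := by
    have hu1 := (h0 u).comp (Filter.tendsto_add_atTop_nat 1)
    have hv1 := (h0 v).comp (Filter.tendsto_add_atTop_nat 1)
    have hlim := ((hu1.mul (h0 v)).add ((h0 u).mul hv1)).const_mul C
    simp only [mul_zero, add_zero] at hlim
    refine squeeze_zero_norm (fun N => ?_) hlim
    rw [norm_mul, Complex.norm_real, Real.norm_eq_abs]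
    refine mul_le_mul (hC N) ((norm_sub_le _ _).trans
      (add_le_add (norm_inner_le_norm _ _) (norm_inner_le_norm _ _))) (norm_nonneg _)
      ((abs_nonneg _).trans (hC N))
  refine sub_eq_zero.mp (tendsto_nhds_unique h1 (h2.congr fun N => ?_))
  exact (jacobiFun_wronskian _ _ _ _ N).symm

/-- The `T`-periodic Jacobi operator `J_T` with parameters `a, b`, a bounded operator on
`ℓ²(ℕ; ℂ)`. -/
def jacobi {T : ℕ} [NeZero T] (a b : Fin T → ℝ) : Ell2 →L[ℂ] Ell2 :=
  (isSymmetric_jacobiLinear a b).toSelfAdjoint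

theorem jacobi_apply {T : ℕ} [NeZero T] (a b : Fin T → ℝ) (u : Ell2) (n : ℕ) :
    jacobi a b u n = jacobiFun (perExt a) (perExt b) u n := rfl

theorem isSelfAdjoint_jacobi {T : ℕ} [NeZero T] (a b : Fin T → ℝ) : IsSelfAdjoint (jacobi a b) :=
  (isSymmetric_jacobiLinear a b).toSelfAdjoint.2

/-- The parameter space `(ℝ⁺)^T × ℝ^T`, inside `ℝ^T × ℝ^T`. -/
def parameterSpace (T : ℕ) : Set ((Fin T → ℝ) × (Fin T → ℝ)) :=
  {p | ∀ i, 0 < p.1 i}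

/-- `S ⊆ ℂ` is the union of `T` nondegenerate, pairwise disjoint compact intervals of the real line,
listed from left to right. -/
def IsUnionOfDistinctRealIntervals (T : ℕ) (S : Set ℂ) : Prop :=
  ∃ α β : Fin T → ℝ, (∀ i, α i < β i) ∧ (∀ i j, i < j → β i < α j) ∧
    S = Complex.ofReal '' ⋃ i, Set.Icc (α i) (β i)

end PeriodicJacobi

end

/-!
# Essential and absolutely continuous spectrum of periodic Jacobi operators

Let `Q` be the trace of the product of the matrices `!![x - b_n, -1; a_n ^ 2, 0]` over one period, a
monic polynomial of degree `T` in `x`, and let `P = a_0 ⋯ a_{T-1}`. Then `Q / P` is the usual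
discriminant, and everything follows from its relation to the Jacobi operator `J`.

*The essential spectrum is `{z | Q(z) ∈ [-2 P, 2 P]}`* (`mem_essentialSpectrum_jacobi_iff`). By the
Cayley–Hamilton theorem for the transfer matrix over a period, `Q(J)` maps `e_n` to
`P (e_{n+T} + e_{n-T})` for `n ≥ T` (`aeval_discPoly_stdBasis`). So `Q(J)` is a finite rank
perturbation of `P (S + S*)` with an isometry `S`, and the spectrum of `S + S*` is contained in
`[-2, 2]`. If `Q(z)` is not in `[-2 P, 2 P]`, then `Q(J) - Q(z)` is Fredholm, and so is its factor
`J - z`. If `Q(z)` is in the interval, there is a Floquet solution of constant modulus from one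
period to the next, and its restrictions to long windows far from the boundary show that `J - z` is
not Fredholm.

*Bands.* In particular all complex solutions of `Q(z) = ± 2 P` lie in the spectrum of `J`, hence are
real. If they are simple, `Q ^ 2 - 4 P ^ 2` has `2 T` distinct real zeros, and counting signs shows
that it is nonpositive exactly on `T` disjoint intervals. Simplicity is the nonvanishing of the
product of two resultants, which is a polynomial in `(a, b)`. It is nonzero at `a = 0` with distinct
`b_n`, so its zero set is closed and of measure zero.

*Absolutely continuous spectrum.* The vector `e_0` is cyclic. The diagonal resolvent element
`m(z) = ⟨e_0, (J - z)⁻¹ e_0⟩` solves a quadratic equation whose coefficients are polynomials in `z`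
(`resolvent_quadratic`), so `m` stays bounded near each point that is not a zero of the leading
coefficient. Bounds on `m` near the real axis bound the spectral measure of small intervals, so the
spectral measure of `e_0` is absolutely continuous off a finite set `Z`. As eigenspaces are
finite-dimensional, points of the essential spectrum are not isolated in the spectrum, so they are
limits of points of the spectrum outside `Z`; there, bump functions of `J` applied to `e_0` are
approximate eigenvectors in the absolutely continuous subspace
(`essentialSpectrum_subset_acSpectrum`). Conversely, if `J - z` is Fredholm, it is inverted on the
orthogonal complement of its kernel by an operator commuting with `J`; the absolutely continuous
subspace is contained in that complement and invariant under the commutant of `J`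
(`acSpectrum_subset_essentialSpectrum`).
-/

namespace PeriodicJacobi

/-! ### Transfer matrices over a commutative ring -/

section Transfer

open Matrix

variable {R : Type*} [CommRing R]

/-- The transfer matrix of the recursion `a_n u_{n+1} = (x - b_n) u_n - t_n`, `t_{n+1} = a_n u_n`,
acting on `(u_n, t_n)` and multiplied by `a_n`, so that its entries are polynomials in `a_n`, `b_n`
and `x`. -/
def transferMatrix (a b x : R) : Matrix (Fin 2) (Fin 2) R := !![x - b, -1; a ^ 2, 0]

/-- The product of the `k` transfer matrices with indices `n, …, n + k - 1`. -/
def transferProd (a b : ℕ → R) (x : R) (n : ℕ) : ℕ → Matrix (Fin 2) (Fin 2) R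
  | 0 => 1
  | k + 1 => transferMatrix (a (n + k)) (b (n + k)) x * transferProd a b x n k

/-- The discriminant of the period `T`, multiplied by `a_0 ⋯ a_{T-1}`: the trace of the transfer
matrix over one period. -/
def discriminant (a b : ℕ → R) (x : R) (T : ℕ) : R := (transferProd a b x 0 T).trace

theorem det_transferMatrix (a b x : R) : (transferMatrix a b x).det = a ^ 2 := by
  simp [transferMatrix, det_fin_two]

theorem transferProd_add (a b : ℕ → R) (x : R) (n k l : ℕ) :
    transferProd a b x n (k + l) = transferProd a b x (n + k) l * transferProd a b x n k := by
  induction l with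
  | zero => simp [transferProd]
  | succ l ih =>
    rw [← add_assoc, transferProd, transferProd, ih, mul_assoc, add_assoc]

theorem det_transferProd (a b : ℕ → R) (x : R) (n k : ℕ) :
    (transferProd a b x n k).det = (∏ j ∈ Finset.range k, a (n + j)) ^ 2 := by
  induction k with
  | zero => simp [transferProd]
  | succ k ih =>
    rw [transferProd, det_mul, det_transferMatrix, ih, Finset.prod_range_succ]
    ring

theorem transferProd_shift {a b : ℕ → R} {T : ℕ} (ha : ∀ n, a (n + T) = a n)
    (hb : ∀ n, b (n + T) = b n) (x : R) (n k : ℕ) :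
    transferProd a b x (n + T) k = transferProd a b x n k := by
  induction k with
  | zero => rfl
  | succ k ih => rw [transferProd, transferProd, ih, add_right_comm, ha, hb]

theorem transferProd_succ_eq_mul (a b : ℕ → R) (x : R) (n k : ℕ) :
    transferProd a b x n (k + 1) =
      transferProd a b x (n + 1) k * transferMatrix (a n) (b n) x := by
  rw [add_comm k 1, transferProd_add]
  simp [transferProd]

/-- The trace over one period does not depend on where the period starts. -/
theorem trace_transferProd {a b : ℕ → R} {T : ℕ} (ha : ∀ n, a (n + T) = a n)
    (hb : ∀ n, b (n + T) = b n) (x : R) (n : ℕ) :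
    (transferProd a b x n T).trace = discriminant a b x T := by
  cases T with
  | zero => rfl
  | succ k =>
    induction n with
    | zero => rfl
    | succ n ih =>
      rw [← ih, transferProd_succ_eq_mul a b x n, trace_mul_comm, transferProd,
        add_right_comm n 1 k, add_assoc n k 1, ha, hb]

/-- The polynomials of the first kind, normalised to be monic: `P_n = p_n a_0 ⋯ a_{n-1}`, where
`p_n` is the formal eigenvector with `p_0 = 1`. -/
def firstKind (a b : ℕ → R) (x : R) (n : ℕ) : R := transferProd a b x 0 n 0 0

theorem firstKind_zero (a b : ℕ → R) (x : R) : firstKind a b x 0 = 1 := by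
  simp [firstKind, transferProd]

theorem transferProd_one_zero (a b : ℕ → R) (x : R) (n : ℕ) :
    transferProd a b x 0 (n + 1) 1 0 = a n ^ 2 * firstKind a b x n := by
  simp [firstKind, transferProd, transferMatrix, Matrix.mul_apply, Fin.sum_univ_two]

theorem firstKind_one (a b : ℕ → R) (x : R) : firstKind a b x 1 = x - b 0 := by
  simp [firstKind, transferProd, transferMatrix]

theorem firstKind_add_two (a b : ℕ → R) (x : R) (n : ℕ) :
    firstKind a b x (n + 2) =
      (x - b (n + 1)) * firstKind a b x (n + 1) - a n ^ 2 * firstKind a b x n := by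
  rw [← transferProd_one_zero, firstKind, transferProd, mul_apply, Fin.sum_univ_two]
  simp [firstKind, transferMatrix, sub_eq_add_neg]

/-- Multiplication by the discriminant shifts the index of the polynomials of the first kind by one
period in both directions. This is the Cayley–Hamilton theorem for the transfer matrix over one
period. -/
theorem discriminant_mul_firstKind {a b : ℕ → R} {T : ℕ} (ha : ∀ n, a (n + T) = a n)
    (hb : ∀ n, b (n + T) = b n) (x : R) (n : ℕ) :
    discriminant a b x T * firstKind a b x (n + T) =
      firstKind a b x (n + T + T) +
        (∏ j ∈ Finset.range T, a (n + j)) ^ 2 * firstKind a b x n := by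
  set W := transferProd a b x n T with hW
  have h1 : transferProd a b x 0 (n + T) = W * transferProd a b x 0 n := by
    rw [transferProd_add, zero_add]
  have h2 : transferProd a b x 0 (n + T + T) = W * (W * transferProd a b x 0 n) := by
    rw [transferProd_add, zero_add, transferProd_shift ha hb, h1]
  rw [← det_transferProd a b x, ← trace_transferProd ha hb x n, ← hW]
  simp only [firstKind, h1, h2, trace_fin_two, det_fin_two, mul_apply, Fin.sum_univ_two]
  ring

theorem map_transferProd {S : Type*} [CommRing S] (φ : R →+* S) (a b : ℕ → R) (x : R) (n k : ℕ) :
    (transferProd a b x n k).map φ = transferProd (φ ∘ a) (φ ∘ b) (φ x) n k := by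
  induction k with
  | zero => ext i j; simp [transferProd, Matrix.one_apply, apply_ite φ]
  | succ k ih =>
    rw [transferProd, transferProd, Matrix.map_mul, ih]
    congr 1
    ext i j
    fin_cases i <;> fin_cases j <;> simp [transferMatrix]

theorem map_discriminant {S : Type*} [CommRing S] (φ : R →+* S) (a b : ℕ → R) (x : R) (T : ℕ) :
    φ (discriminant a b x T) = discriminant (φ ∘ a) (φ ∘ b) (φ x) T := by
  rw [discriminant, discriminant, ← map_transferProd, trace_fin_two, trace_fin_two, map_add]
  rfl

theorem discriminant_zero (b : ℕ → R) (x : R) (T : ℕ) [NeZero T] :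
    discriminant 0 b x T = ∏ j ∈ Finset.range T, (x - b j) := by
  have h : ∀ k, transferProd 0 b x 0 (k + 1) 0 0 = ∏ j ∈ Finset.range (k + 1), (x - b j) ∧
      transferProd 0 b x 0 (k + 1) 1 = 0 := by
    intro k
    have h1 : transferProd 0 b x 0 (k + 1) 1 = 0 := by
      ext j
      fin_cases j <;> simp [transferProd, transferMatrix, Matrix.mul_apply]
    refine ⟨?_, h1⟩
    induction k with
    | zero => simp [transferProd, transferMatrix]
    | succ k ih =>
      have h2 : transferProd 0 b x 0 (k + 1) 1 = 0 := by
        ext j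
        fin_cases j <;> simp [transferProd, transferMatrix, Matrix.mul_apply]
      rw [Finset.prod_range_succ, transferProd, Matrix.mul_apply, Fin.sum_univ_two, ih h2, h2]
      simp [transferMatrix, mul_comm]
  obtain ⟨k, rfl⟩ := Nat.exists_eq_succ_of_ne_zero (NeZero.ne T)
  rw [discriminant, trace_fin_two, (h k).1, congrFun (h k).2 1]
  simp

open Polynomial in
theorem discriminant_monic [Nontrivial R] (a b : ℕ → R) (T : ℕ) [NeZero T] :
    (discriminant (C ∘ a) (C ∘ b) (X : R[X]) T).Monic ∧
      (discriminant (C ∘ a) (C ∘ b) (X : R[X]) T).natDegree = T := by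
  -- Track degrees through the product: the top left entry is monic of degree `k`, all others
  -- have smaller degree.
  have h : ∀ k, ((transferProd (C ∘ a) (C ∘ b) (X : R[X]) 0 (k + 1) 0 0).Monic ∧
      (transferProd (C ∘ a) (C ∘ b) (X : R[X]) 0 (k + 1) 0 0).degree = ((k + 1 : ℕ) : WithBot ℕ)) ∧
      (transferProd (C ∘ a) (C ∘ b) (X : R[X]) 0 (k + 1) 0 1).degree < ((k + 1 : ℕ) : WithBot ℕ) ∧
      (transferProd (C ∘ a) (C ∘ b) (X : R[X]) 0 (k + 1) 1 0).degree < ((k + 1 : ℕ) : WithBot ℕ) ∧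
      (transferProd (C ∘ a) (C ∘ b) (X : R[X]) 0 (k + 1) 1 1).degree <
        ((k + 1 : ℕ) : WithBot ℕ) := by
    intro k
    induction k with
    | zero =>
      have e1 : transferProd (C ∘ a) (C ∘ b) (X : R[X]) 0 1 0 0 = X - C (b 0) := by
        simp [transferProd, transferMatrix]
      have e2 : transferProd (C ∘ a) (C ∘ b) (X : R[X]) 0 1 0 1 = -1 := by
        simp [transferProd, transferMatrix]
      have e3 : transferProd (C ∘ a) (C ∘ b) (X : R[X]) 0 1 1 0 = C (a 0 ^ 2) := by
        simp [transferProd, transferMatrix]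
      have e4 : transferProd (C ∘ a) (C ∘ b) (X : R[X]) 0 1 1 1 = 0 := by
        simp [transferProd, transferMatrix]
      rw [zero_add, e1, e2, e3, e4]
      refine ⟨⟨monic_X_sub_C _, degree_X_sub_C _⟩, ?_, ?_, ?_⟩
      · rw [degree_neg, degree_one]; norm_num
      · exact degree_C_le.trans_lt (by norm_num)
      · rw [degree_zero]; exact WithBot.bot_lt_coe _
    | succ k ih =>
      obtain ⟨⟨h1, h2⟩, h3, h4, h5⟩ := ih
      set M := transferProd (C ∘ a) (C ∘ b) (X : R[X]) 0 (k + 1) with hM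
      have lt1 : ((k + 1 : ℕ) : WithBot ℕ) < ((k + 1 + 1 : ℕ) : WithBot ℕ) := by
        exact_mod_cast Nat.lt_succ_self _
      have e (j : Fin 2) : transferProd (C ∘ a) (C ∘ b) (X : R[X]) 0 (k + 1 + 1) 0 j =
          (X - C (b (k + 1))) * M 0 j - M 1 j := by
        rw [transferProd, ← hM]
        simp [transferMatrix, Matrix.mul_apply, Fin.sum_univ_two]
        ring
      have e' (j : Fin 2) : transferProd (C ∘ a) (C ∘ b) (X : R[X]) 0 (k + 1 + 1) 1 j =
          C (a (k + 1) ^ 2) * M 0 j := by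
        rw [transferProd, ← hM]
        simp [transferMatrix, Matrix.mul_apply, Fin.sum_univ_two]
      have d1 : ((X - C (b (k + 1))) * M 0 0).degree = ((k + 1 + 1 : ℕ) : WithBot ℕ) := by
        rw [h1.degree_mul, degree_X_sub_C, h2]
        push_cast
        ring
      have hlt : (M 1 0).degree < ((X - C (b (k + 1))) * M 0 0).degree := by
        rw [d1]; exact h4.trans lt1
      have hCle (c : R) (p : R[X]) : (C c * p).degree ≤ p.degree := by
        refine (degree_mul_le _ _).trans ?_
        calc (C c).degree + p.degree ≤ 0 + p.degree := by gcongr; exact degree_C_le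
          _ = p.degree := zero_add _
      refine ⟨⟨?_, ?_⟩, ?_, ?_, ?_⟩
      · rw [e]
        exact ((monic_X_sub_C _).mul h1).sub_of_left hlt
      · rw [e, degree_sub_eq_left_of_degree_lt hlt, d1]
      · rw [e]
        refine (degree_sub_le _ _).trans_lt (max_lt ?_ (h5.trans lt1))
        rw [mul_comm, (monic_X_sub_C (b (k + 1))).degree_mul, degree_X_sub_C, Nat.cast_succ (k + 1)]
        exact WithBot.add_lt_add_right (WithBot.one_ne_bot) h3
      · rw [e']
        exact (hCle _ _).trans_lt (h2.trans_lt lt1)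
      · rw [e']
        exact (hCle _ _).trans_lt (h3.trans lt1)
  obtain ⟨k, rfl⟩ := Nat.exists_eq_succ_of_ne_zero (NeZero.ne T)
  obtain ⟨⟨h1, h2⟩, -, -, h5⟩ := h k
  have hlt := h5.trans_eq h2.symm
  rw [discriminant, trace_fin_two]
  exact ⟨h1.add_of_left hlt, natDegree_eq_of_degree_eq_some
    ((degree_add_eq_left_of_degree_lt hlt).trans h2)⟩

end Transfer

section SelfAdjoint

variable {H : Type*} [NormedAddCommGroup H] [InnerProductSpace ℂ H]

/-! ### Fredholm operators and quasi-inverses -/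

section Fredholm

open LinearMap LinearMap.FiniteRangeSetoid

/-- A right and a left quasi-inverse agree up to finite rank, so that having both suffices. -/
theorem isFredholm_of_left_right {D L R : H →L[ℂ] H}
    (hL : ((L * D - 1 : H →L[ℂ] H) : H →ₗ[ℂ] H).HasFiniteRange)
    (hR : ((D * R - 1 : H →L[ℂ] H) : H →ₗ[ℂ] H).HasFiniteRange) : D.IsFredholm := by
  have h1 : (L : H →ₗ[ℂ] H) ∘ₗ (D : H →ₗ[ℂ] H) ≈ LinearMap.id :=
    equiv_iff_hasFiniteRange.mpr hL
  have h2 : (D : H →ₗ[ℂ] H) ∘ₗ (R : H →ₗ[ℂ] H) ≈ LinearMap.id :=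
    equiv_iff_hasFiniteRange.mpr hR
  have h3 : (R : H →ₗ[ℂ] H) ≈ (L : H →ₗ[ℂ] H) := by
    calc (R : H →ₗ[ℂ] H) = LinearMap.id ∘ₗ (R : H →ₗ[ℂ] H) := rfl
      _ ≈ ((L : H →ₗ[ℂ] H) ∘ₗ (D : H →ₗ[ℂ] H)) ∘ₗ (R : H →ₗ[ℂ] H) :=
        equiv_comp_right (Setoid.symm h1)
      _ = (L : H →ₗ[ℂ] H) ∘ₗ ((D : H →ₗ[ℂ] H) ∘ₗ (R : H →ₗ[ℂ] H)) := rfl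
      _ ≈ (L : H →ₗ[ℂ] H) ∘ₗ LinearMap.id := equiv_comp_left h2
      _ = L := rfl
  exact ContinuousLinearMap.IsFredholm.of_isQuasiInverse (v := R)
    ⟨Setoid.trans (equiv_comp_right h3) h1, h2⟩

/-- If `D` commutes with `q` and `D q` is a finite rank perturbation of an invertible operator, then
`D` is Fredholm. -/
theorem isFredholm_of_commute {D q : H →L[ℂ] H} (h : Commute D q) (E : (H →L[ℂ] H)ˣ)
    (hF : ((D * q - E : H →L[ℂ] H) : H →ₗ[ℂ] H).HasFiniteRange) : D.IsFredholm := by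
  refine isFredholm_of_left_right (L := (↑E⁻¹ : H →L[ℂ] H) * q) (R := q * (↑E⁻¹ : H →L[ℂ] H)) ?_ ?_
  · have e : (↑E⁻¹ : H →L[ℂ] H) * q * D - 1 = (↑E⁻¹ : H →L[ℂ] H) * (D * q - E) := by
      rw [mul_sub, Units.inv_mul, mul_assoc, h.eq]
    rw [e]
    exact hF.comp_left _
  · have e : D * (q * (↑E⁻¹ : H →L[ℂ] H)) - 1 = (D * q - E) * (↑E⁻¹ : H →L[ℂ] H) := by
      rw [sub_mul, Units.mul_inv, mul_assoc]
    rw [e]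
    exact hF.comp_right _

theorem isFredholm_of_isUnit {D : H →L[ℂ] H} (hD : IsUnit D) : D.IsFredholm := by
  obtain ⟨E, rfl⟩ := hD
  refine isFredholm_of_commute (Commute.one_right _) E ?_
  simp

theorem essentialSpectrum_subset_spectrum (A : H →L[ℂ] H) : essentialSpectrum A ⊆ spectrum ℂ A := by
  intro z hz hu
  refine hz ?_
  have h : IsUnit (A - z • ContinuousLinearMap.id ℂ H) := by
    have := IsUnit.neg hu
    rwa [neg_sub, Algebra.algebraMap_eq_smul_one] at this
  exact isFredholm_of_isUnit h

end Fredholm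

/-! ### Functional calculus estimates -/

variable [CompleteSpace H] {A : H →L[ℂ] H}

theorem norm_cfc_apply_sq (A : H →L[ℂ] H) (ψ : H) {f : ℝ → ℝ} (hf : Continuous f) :
    ‖cfc f A ψ‖ ^ 2 = (⟪ψ, cfc (fun x => f x * f x) A ψ⟫_ℂ).re := by
  have hs : IsSelfAdjoint (cfc f A) := cfc_predicate f A
  have h := hs.isSymmetric ψ (cfc f A ψ)
  rw [cfc_mul f f A hf.continuousOn hf.continuousOn]
  change _ = (⟪ψ, cfc f A (cfc f A ψ)⟫_ℂ).re
  rw [← inner_self_eq_norm_sq (𝕜 := ℂ)]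
  exact congrArg Complex.re h

theorem norm_cfc_apply_le (A : H →L[ℂ] H) (ψ : H) {f g : ℝ → ℝ} (hf : Continuous f)
    (hg : Continuous g) (h : ∀ x, |f x| ≤ |g x|) : ‖cfc f A ψ‖ ≤ ‖cfc g A ψ‖ := by
  refine (pow_le_pow_iff_left₀ (norm_nonneg _) (norm_nonneg _) two_ne_zero).mp ?_
  rw [norm_cfc_apply_sq A ψ hf, norm_cfc_apply_sq A ψ hg]
  have h1 : cfc (fun x => f x * f x) A ≤ cfc (fun x => g x * g x) A :=
    cfc_mono (fun x _ => by simpa only [abs_mul_abs_self] using mul_self_le_mul_self (abs_nonneg _) (h x)) (hf.mul hf).continuousOn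
      (hg.mul hg).continuousOn
  rw [← sub_nonneg, ContinuousLinearMap.nonneg_iff_isPositive] at h1
  have h2 := h1.re_inner_nonneg_right ψ
  simp only [sub_apply, inner_sub_right, map_sub] at h2
  exact sub_nonneg.mp h2

theorem cfc_sub_const (hA : IsSelfAdjoint A) (c : ℝ) :
    cfc (fun x : ℝ => x - c) A = A - (c : ℂ) • ContinuousLinearMap.id ℂ H := by
  rw [cfc_sub (fun x : ℝ => x) (fun _ : ℝ => c) A continuousOn_id continuousOn_const, cfc_id' ℝ A,
    cfc_const c A, Algebra.algebraMap_eq_smul_one, Complex.coe_smul]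
  rfl

theorem cfc_mul_sub_const (hA : IsSelfAdjoint A) (c : ℝ) {f : ℝ → ℝ} (hf : Continuous f) :
    cfc (fun x : ℝ => (x - c) * f x) A = (A - (c : ℂ) • ContinuousLinearMap.id ℂ H) * cfc f A := by
  rw [cfc_mul (fun x : ℝ => x - c) f A (by fun_prop) hf.continuousOn, cfc_sub_const hA]

theorem cfc_mul_sub_const' (hA : IsSelfAdjoint A) (c : ℝ) {f : ℝ → ℝ} (hf : Continuous f) :
    cfc (fun x : ℝ => (x - c) * f x) A = cfc f A * (A - (c : ℂ) • ContinuousLinearMap.id ℂ H) := by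
  rw [← cfc_sub_const hA, ← cfc_mul f (fun x : ℝ => x - c) A hf.continuousOn (by fun_prop)]
  simp only [mul_comm]

/-! ### Bump functions -/

/-- A continuous function with values in `[0, 1]`, equal to `1` where `|x - c| ≤ r` and to `0` where
`2 r ≤ |x - c|`. -/
noncomputable def plateau (c r : ℝ) (x : ℝ) : ℝ := max 0 (min 1 (2 - |x - c| / r))

theorem continuous_plateau (c r : ℝ) : Continuous (plateau c r) := by
  unfold plateau; fun_prop

theorem plateau_nonneg (c r x : ℝ) : 0 ≤ plateau c r x := le_max_left _ _

theorem plateau_le_one (c r x : ℝ) : plateau c r x ≤ 1 := max_le zero_le_one (min_le_left _ _)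

theorem plateau_eq_one {c r x : ℝ} (hr : 0 < r) (h : |x - c| ≤ r) : plateau c r x = 1 := by
  have : |x - c| / r ≤ 1 := (div_le_one hr).mpr h
  rw [plateau, min_eq_left (by linarith), max_eq_right zero_le_one]

theorem plateau_eq_zero {c r x : ℝ} (hr : 0 < r) (h : 2 * r ≤ |x - c|) : plateau c r x = 0 := by
  have : 2 ≤ |x - c| / r := (le_div_iff₀ hr).mpr h
  rw [plateau, max_eq_left ((min_le_right _ _).trans (by linarith))]

theorem hasCompactSupport_plateau {c r : ℝ} (hr : 0 < r) : HasCompactSupport (plateau c r) := by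
  refine HasCompactSupport.intro (isCompact_closedBall c (2 * r)) fun x hx => ?_
  rw [Metric.mem_closedBall, Real.dist_eq, not_le] at hx
  exact plateau_eq_zero hr hx.le

theorem abs_sub_mul_plateau_le {c r : ℝ} (hr : 0 < r) (x : ℝ) :
    |(x - c) * plateau c r x| ≤ |2 * r * plateau c r x| := by
  rw [abs_mul, abs_mul (2 * r), abs_of_pos (by linarith : 0 < 2 * r)]
  rcases le_total (2 * r) |x - c| with h | h
  · simp [plateau_eq_zero hr h]
  · exact mul_le_mul_of_nonneg_right h (abs_nonneg _)

theorem abs_one_sub_plateau_le {c r : ℝ} (hr : 0 < r) (x : ℝ) :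
    |1 - plateau c r x| ≤ |r⁻¹ * (x - c)| := by
  rw [abs_of_nonneg (sub_nonneg.mpr (plateau_le_one _ _ _)), abs_mul, abs_of_pos (inv_pos.mpr hr)]
  rcases le_total |x - c| r with h | h
  · rw [plateau_eq_one hr h, sub_self]; positivity
  · have h1 : 1 ≤ r⁻¹ * |x - c| := by rw [inv_mul_eq_div]; exact (one_le_div hr).mpr h
    linarith [plateau_nonneg c r x]

theorem norm_sub_apply_plateau_le (hA : IsSelfAdjoint A) {c r : ℝ} (hr : 0 < r) (ψ : H) :
    ‖(A - (c : ℂ) • ContinuousLinearMap.id ℂ H) (cfc (plateau c r) A ψ)‖ ≤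
      2 * r * ‖cfc (plateau c r) A ψ‖ := by
  have h := norm_cfc_apply_le A ψ (f := fun x => (x - c) * plateau c r x)
    (g := fun x => 2 * r * plateau c r x)
    (by have := continuous_plateau c r; fun_prop)
    (by have := continuous_plateau c r; fun_prop) (abs_sub_mul_plateau_le hr)
  rw [cfc_mul_sub_const hA c (continuous_plateau c r),
    cfc_const_mul (2 * r) (plateau c r) A (continuous_plateau c r).continuousOn] at h
  refine h.trans_eq ?_
  rw [smul_apply, norm_smul, Real.norm_of_nonneg (by linarith)]

theorem norm_plateau_apply_le (hA : IsSelfAdjoint A) (c r : ℝ)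
    (ψ : H) : ‖cfc (plateau c r) A ψ‖ ≤ ‖ψ‖ := by
  have h := norm_cfc_apply_le A ψ (f := plateau c r) (g := fun _ => 1)
    (continuous_plateau c r) continuous_const fun x => by
      rw [abs_of_nonneg (plateau_nonneg _ _ _), abs_one]; exact plateau_le_one _ _ _
  rwa [cfc_const_one ℝ A] at h

/-- An eigenvector is fixed by every function of `A` that equals `1` near the eigenvalue. -/
theorem plateau_apply_eigenvector (hA : IsSelfAdjoint A) {c r : ℝ} (hr : 0 < r) {ψ : H}
    (hψ : (A - (c : ℂ) • ContinuousLinearMap.id ℂ H) ψ = 0) : cfc (plateau c r) A ψ = ψ := by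
  have h := norm_cfc_apply_le A ψ (f := fun x => 1 - plateau c r x)
    (g := fun x => r⁻¹ * (x - c)) (by have := continuous_plateau c r; fun_prop) (by fun_prop)
    (abs_one_sub_plateau_le hr)
  rw [cfc_const_mul r⁻¹ (fun x => x - c) A (by fun_prop), cfc_sub_const hA, smul_apply, hψ,
    smul_zero, norm_zero, cfc_sub (fun _ => 1) (plateau c r) A continuousOn_const
    (continuous_plateau c r).continuousOn, cfc_const_one ℝ A] at h
  exact (sub_eq_zero.mp (norm_le_zero_iff.mp h)).symm

end SelfAdjoint

section AbsolutelyContinuous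

variable {H : Type*} [NormedAddCommGroup H] [InnerProductSpace ℂ H] [CompleteSpace H]
  {A : H →L[ℂ] H}

/-! ### Spectral measures -/

theorem spectralMeasure_closedBall_le (A : H →L[ℂ] H) (ψ : H) {c r : ℝ} (hr : 0 < r) :
    spectralMeasure A ψ (Metric.closedBall c r) ≤
      ENNReal.ofReal (‖cfc (plateau c r) A ψ‖ ^ 2) := by
  let f : C_c(ℝ, ℝ) :=
    { toFun := fun x => plateau c r x * plateau c r x
      continuous_toFun := (continuous_plateau c r).mul (continuous_plateau c r)
      hasCompactSupport' := (hasCompactSupport_plateau hr).mul_left }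
  refine (RealRMK.rieszMeasure_le_of_eq_one (spectralFunctional A ψ) (f := f)
    (fun x => mul_self_nonneg _) (isCompact_closedBall c r) fun x hx => ?_).trans_eq ?_
  · have h : plateau c r x = 1 := plateau_eq_one hr (by simpa [Real.dist_eq] using hx)
    change plateau c r x * plateau c r x = 1
    rw [h, one_mul]
  · rw [norm_cfc_apply_sq A ψ (continuous_plateau c r)]
    rfl

theorem norm_plateau_sq_le (A : H →L[ℂ] H) (ψ : H) {c r : ℝ} (hr : 0 < r) :
    ENNReal.ofReal (‖cfc (plateau c r) A ψ‖ ^ 2) ≤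
      spectralMeasure A ψ (Metric.closedBall c (2 * r)) := by
  let f : C_c(ℝ, ℝ) :=
    { toFun := fun x => plateau c r x * plateau c r x
      continuous_toFun := (continuous_plateau c r).mul (continuous_plateau c r)
      hasCompactSupport' := (hasCompactSupport_plateau hr).mul_left }
  refine Eq.trans_le ?_ (RealRMK.le_rieszMeasure_tsupport_subset (spectralFunctional A ψ) (f := f)
    (fun x => ⟨mul_self_nonneg _, mul_le_one₀ (plateau_le_one _ _ _) (plateau_nonneg _ _ _)
      (plateau_le_one _ _ _)⟩) ?_)
  · rw [norm_cfc_apply_sq A ψ (continuous_plateau c r)]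
    rfl
  · refine closure_minimal (fun x hx => ?_) Metric.isClosed_closedBall
    by_contra h
    rw [Metric.mem_closedBall, Real.dist_eq, not_le] at h
    refine hx ?_
    change plateau c r x * plateau c r x = 0
    rw [plateau_eq_zero hr h.le, zero_mul]

theorem spectralMeasure_absolutelyContinuous_of_le {φ χ : H} (C : ℝ)
    (h : ∀ f : C_c(ℝ, ℝ), (∀ x, 0 ≤ f x) →
      (⟪φ, cfc (fun x : ℝ => f x) A φ⟫_ℂ).re ≤ C * (⟪χ, cfc (fun x : ℝ => f x) A χ⟫_ℂ).re) :
    spectralMeasure A φ ≪ spectralMeasure A χ := by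
  refine Measure.AbsolutelyContinuous.mk fun s hs h0 => ?_
  by_contra hne
  obtain ⟨K, hKs, hK, hpos⟩ := hs.exists_lt_isCompact (pos_iff_ne_zero.mpr hne)
  refine hpos.ne' (le_antisymm ?_ zero_le)
  refine ENNReal.le_of_forall_pos_le_add fun ε hε _ => ?_
  rw [zero_add]
  have hKχ : spectralMeasure A χ K < ENNReal.ofReal (ε / (|C| + 1)) := by
    rw [measure_mono_null hKs h0]
    exact ENNReal.ofReal_pos.mpr (by positivity)
  obtain ⟨U, hKU, hU, hUε⟩ := K.exists_isOpen_lt_of_lt _ hKχ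
  obtain ⟨L, hL, hKL, hLU⟩ := exists_compact_between hK hU hKU
  obtain ⟨f, hf1, hf0, hfc, hf⟩ := exists_continuous_one_zero_of_isCompact hK
    (isOpen_interior (s := L)).isClosed_compl (Set.disjoint_compl_right_iff_subset.mpr hKL)
  let g : C_c(ℝ, ℝ) := { toFun := f, continuous_toFun := f.continuous, hasCompactSupport' := hfc }
  have hg : tsupport g ⊆ U := by
    refine (closure_minimal (fun x hx => ?_) hL.isClosed).trans hLU
    by_contra hxL
    exact hx (hf0 fun hi => hxL (interior_subset hi))
  have h1 := RealRMK.rieszMeasure_le_of_eq_one (spectralFunctional A φ) (f := g)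
    (fun x => (hf x).1) hK fun x hx => hf1 hx
  have h2 := (RealRMK.le_rieszMeasure_tsupport_subset (spectralFunctional A χ) (f := g)
    (fun x => hf x) hg).trans hUε.le
  rw [ENNReal.ofReal_le_ofReal_iff (by positivity)] at h2
  refine h1.trans ?_
  rw [← ENNReal.ofReal_coe_nnreal]
  refine ENNReal.ofReal_le_ofReal ((h g fun x => (hf x).1).trans ?_)
  have h3 : 0 ≤ (⟪χ, cfc (fun x : ℝ => g x) A χ⟫_ℂ).re := by
    have : 0 ≤ cfc (fun x : ℝ => g x) A := cfc_nonneg fun x _ => (hf x).1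
    rw [ContinuousLinearMap.nonneg_iff_isPositive] at this
    exact this.re_inner_nonneg_right χ
  change (⟪χ, cfc (fun x : ℝ => g x) A χ⟫_ℂ).re ≤ _ at h2
  calc C * (⟪χ, cfc (fun x : ℝ => g x) A χ⟫_ℂ).re
      ≤ (|C| + 1) * (⟪χ, cfc (fun x : ℝ => g x) A χ⟫_ℂ).re :=
        mul_le_mul_of_nonneg_right (by linarith [le_abs_self C]) h3
    _ ≤ (|C| + 1) * (ε / (|C| + 1)) := mul_le_mul_of_nonneg_left h2 (by positivity)
    _ = ε := by field_simp

/-- A bounded operator commuting with `A` maps the absolutely continuous subspace to itself: it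
changes spectral measures by at most the factor `‖B‖²`. -/
theorem apply_mem_acSubspace (hA : IsSelfAdjoint A) {B : H →L[ℂ] H} (hB : Commute A B) {φ : H}
    (hφ : φ ∈ acSubspace A) : B φ ∈ acSubspace A := by
  refine Measure.AbsolutelyContinuous.trans
    (spectralMeasure_absolutelyContinuous_of_le (‖B‖ ^ 2) fun f hf => ?_) hφ
  -- `⟨Bφ, f(A) Bφ⟩ = ‖B √f(A) φ‖²`
  have hc : Continuous fun x : ℝ => √(f x) := f.continuous.sqrt
  have e (χ : H) : (⟪χ, cfc (fun x : ℝ => f x) A χ⟫_ℂ).re = ‖cfc (fun x : ℝ => √(f x)) A χ‖ ^ 2 := by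
    rw [norm_cfc_apply_sq A χ hc]
    simp only [Real.mul_self_sqrt (hf _)]
  have hcomm : Commute (cfc (fun x : ℝ => √(f x)) A) B := hA.commute_cfc hB _
  have e2 : cfc (fun x : ℝ => √(f x)) A (B φ) = B (cfc (fun x : ℝ => √(f x)) A φ) :=
    congrArg (fun D : H →L[ℂ] H => D φ) hcomm.eq
  rw [e, e, e2, ← mul_pow]
  exact pow_le_pow_left₀ (norm_nonneg _) (B.le_opNorm _) 2

/-- Eigenvectors are orthogonal to the absolutely continuous subspace. -/
theorem inner_eigenvector_eq_zero (hA : IsSelfAdjoint A) {c : ℝ} {ψ φ : H}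
    (hψ : (A - (c : ℂ) • ContinuousLinearMap.id ℂ H) ψ = 0) (hφ : φ ∈ acSubspace A) :
    ⟪ψ, φ⟫_ℂ = 0 := by
  have h0 : spectralMeasure A φ {c} = 0 := hφ (measure_singleton c)
  have key : ∀ ε : ℝ, 0 < ε → ‖⟪ψ, φ⟫_ℂ‖ ≤ ‖ψ‖ * ε := by
    intro ε hε
    have hlt : spectralMeasure A φ {c} < ENNReal.ofReal (ε ^ 2) := by
      rw [h0]; exact ENNReal.ofReal_pos.mpr (by positivity)
    obtain ⟨U, hcU, hU, hUε⟩ := Set.exists_isOpen_lt_of_lt {c} _ hlt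
    obtain ⟨r, hr, hrU⟩ := Metric.nhds_basis_closedBall.mem_iff.mp
      (hU.mem_nhds (hcU (Set.mem_singleton c)))
    have hr2 : 0 < r / 2 := by linarith
    have h1 := (norm_plateau_sq_le A φ (c := c) hr2).trans ((measure_mono
      ((by rw [mul_div_cancel₀ r two_ne_zero] : Metric.closedBall c (2 * (r / 2)) ⊆
        Metric.closedBall c r).trans hrU)).trans hUε.le)
    rw [ENNReal.ofReal_le_ofReal_iff (by positivity),
      pow_le_pow_iff_left₀ (norm_nonneg _) hε.le two_ne_zero] at h1
    have hs : IsSelfAdjoint (cfc (plateau c (r / 2)) A) := cfc_predicate _ A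
    have h2 := hs.isSymmetric ψ φ
    change ⟪cfc (plateau c (r / 2)) A ψ, φ⟫_ℂ = ⟪ψ, cfc (plateau c (r / 2)) A φ⟫_ℂ at h2
    rw [plateau_apply_eigenvector hA hr2 hψ] at h2
    rw [h2]
    exact (norm_inner_le_norm _ _).trans (mul_le_mul_of_nonneg_left h1 (norm_nonneg _))
  have hlim : Filter.Tendsto (fun ε : ℝ => ‖ψ‖ * ε) (nhdsWithin 0 (Set.Ioi 0)) (nhds 0) := by
    have : Filter.Tendsto (fun ε : ℝ => ‖ψ‖ * ε) (nhds 0) (nhds (‖ψ‖ * 0)) :=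
      (continuous_const.mul continuous_id).tendsto 0
    rw [mul_zero] at this
    exact this.mono_left nhdsWithin_le_nhds
  exact norm_le_zero_iff.mp (ge_of_tendsto hlim (Filter.eventually_of_mem self_mem_nhdsWithin key))

/-- An s-finite measure whose small balls around each point of `s` are at most a constant
times their length is absolutely continuous on `s`; the constant may depend on the point. -/
theorem measure_inter_eq_zero_of_closedBall_le (μ : Measure ℝ) [SFinite μ] {s N : Set ℝ}
    (hN : volume N = 0)
    (h : ∀ x ∈ s, ∃ C : ℝ, ∀ᶠ r in nhdsWithin (0 : ℝ) (Set.Ioi 0),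
      μ (Metric.closedBall x r) ≤ ENNReal.ofReal (C * r)) : μ (N ∩ s) = 0 := by
  let S (k : ℕ) : Set ℝ := {x | x ∈ N ∧ ∀ᶠ r in nhdsWithin (0 : ℝ) (Set.Ioi 0),
    μ (Metric.closedBall x r) ≤ ENNReal.ofReal (k * r)}
  have hsub : N ∩ s ⊆ ⋃ k, S k := by
    rintro x ⟨hxN, hxs⟩
    obtain ⟨C, hC⟩ := h x hxs
    obtain ⟨k, hk⟩ := exists_nat_ge C
    refine Set.mem_iUnion.mpr ⟨k, hxN, ?_⟩
    filter_upwards [hC, self_mem_nhdsWithin] with r hr hr0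
    exact hr.trans (ENNReal.ofReal_le_ofReal (mul_le_mul_of_nonneg_right hk (le_of_lt hr0)))
  refine measure_mono_null hsub (measure_iUnion_null fun k => ?_)
  have h1 := (Besicovitch.vitaliFamily μ).measure_le_of_frequently_le ((k : NNReal) • volume)
    Measure.AbsolutelyContinuous.rfl (S k) fun x hx => by
      refine (Besicovitch.tendsto_filterAt μ x).frequently ?_
      refine Filter.Eventually.frequently ?_
      filter_upwards [hx.2, self_mem_nhdsWithin] with r hr hr0
      refine hr.trans ?_
      rw [Measure.smul_apply, Real.volume_closedBall, ENNReal.smul_def, smul_eq_mul,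
        ENNReal.ofReal_mul k.cast_nonneg, ENNReal.ofReal_natCast, ENNReal.coe_natCast]
      gcongr
      have : (0 : ℝ) < r := hr0
      linarith
  refine le_antisymm (h1.trans_eq ?_) zero_le
  rw [Measure.smul_apply, measure_mono_null (fun x hx => hx.1) hN, smul_zero]

/-- If the spectral measure of `φ` is absolutely continuous off a finite set, a function vanishing
on that set moves `φ` into the absolutely continuous subspace. -/
theorem cfc_apply_mem_acSubspace (A : H →L[ℂ] H) {φ : H} {Z : Set ℝ}
    (hφ : ∀ N : Set ℝ, volume N = 0 → spectralMeasure A φ (N ∩ Zᶜ) = 0) {f : ℝ → ℝ}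
    (hf : Continuous f) (hZ : ∀ x ∈ Z, f x = 0) : cfc f A φ ∈ acSubspace A := by
  have hd : Continuous fun x : ℝ => Real.toNNReal (f x ^ 2) := by fun_prop
  have key : spectralMeasure A (cfc f A φ) =
      (spectralMeasure A φ).withDensity (fun x => (Real.toNNReal (f x ^ 2) : ℝ≥0∞)) := by
    have : IsLocallyFiniteMeasure
        ((spectralMeasure A φ).withDensity (fun x => (Real.toNNReal (f x ^ 2) : ℝ≥0∞))) :=
      IsLocallyFiniteMeasure.withDensity_coe hd
    apply Measure.ext_of_integral_eq_on_compactlySupported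
    intro g
    rw [integral_withDensity_eq_integral_smul hd.measurable]
    have hs : HasCompactSupport (fun x : ℝ => f x ^ 2 * g x) :=
      HasCompactSupport.mul_left (f := fun x : ℝ => f x ^ 2) (f' := fun x : ℝ => g x)
        g.hasCompactSupport
    have hc : Continuous (fun x : ℝ => f x ^ 2 * g x) := (hf.pow 2).mul g.continuous
    let k : C_c(ℝ, ℝ) :=
      { toFun := fun x => f x ^ 2 * g x
        continuous_toFun := hc
        hasCompactSupport' := hs }
    have hk : ∀ x : ℝ, Real.toNNReal (f x ^ 2) • g x = k x := fun x => by
      rw [NNReal.smul_def, Real.coe_toNNReal _ (sq_nonneg (f x))]; rfl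
    simp only [hk]
    rw [integral_spectralMeasure, integral_spectralMeasure]
    have h1 : cfc (fun x : ℝ => k x) A = cfc f A * (cfc (fun x : ℝ => g x) A * cfc f A) := by
      rw [← cfc_mul (fun x : ℝ => g x) f A g.continuous.continuousOn hf.continuousOn,
        ← cfc_mul f (fun x : ℝ => g x * f x) A hf.continuousOn
          (g.continuous.mul hf).continuousOn]
      congr 1
      funext x
      change f x ^ 2 * g x = _
      ring
    rw [h1]
    have hs : IsSelfAdjoint (cfc f A) := cfc_predicate f A
    exact congrArg Complex.re (hs.isSymmetric φ (cfc (fun x : ℝ => g x) A (cfc f A φ)))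
  change spectralMeasure A (cfc f A φ) ≪ _
  rw [key]
  refine Measure.AbsolutelyContinuous.mk fun N hN h0 => ?_
  rw [withDensity_apply _ hN, lintegral_eq_zero_iff (by fun_prop)]
  rw [Filter.EventuallyEq, ae_restrict_iff' hN, ae_iff]
  refine measure_mono_null (fun x hx => ?_) (hφ N h0)
  simp only [Set.mem_ofPred_eq, Classical.not_imp] at hx
  refine ⟨hx.1, fun hxZ => hx.2 ?_⟩
  simp [hZ x hxZ]

end AbsolutelyContinuous

section SpectrumComparison

variable {H : Type*} [NormedAddCommGroup H] [InnerProductSpace ℂ H] [CompleteSpace H]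
  {A : H →L[ℂ] H}

/-! ### Essential versus absolutely continuous spectrum -/

/-- An isolated point of the spectrum with a finite-dimensional eigenspace is not in the essential
spectrum. -/
theorem isFredholm_of_isolated (hA : IsSelfAdjoint A) {c r : ℝ} (hr : 0 < r)
    (hker : FiniteDimensional ℂ (A - (c : ℂ) • ContinuousLinearMap.id ℂ H).ker)
    (h : ∀ x ∈ spectrum ℝ A, |x - c| < r → x = c) :
    (A - (c : ℂ) • ContinuousLinearMap.id ℂ H).IsFredholm := by
  set D := A - (c : ℂ) • ContinuousLinearMap.id ℂ H with hD
  -- a continuous function that equals `1 / (x - c)` on the spectrum, except at `c`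
  let g : ℝ → ℝ := fun x => (x - c) / max ((x - c) ^ 2) (r ^ 2)
  have hpos (x : ℝ) : 0 < max ((x - c) ^ 2) (r ^ 2) := lt_max_of_lt_right (by positivity)
  have hg : Continuous g := by
    refine Continuous.div (by fun_prop) (by fun_prop) fun x => (hpos x).ne'
  have hg1 : Continuous fun x => (x - c) * g x := by fun_prop
  have hz : D * (D * cfc g A - 1) = 0 := by
    rw [← cfc_mul_sub_const hA c hg, ← cfc_const_one ℝ A,
      ← cfc_sub _ _ A hg1.continuousOn continuousOn_const,
      ← cfc_mul_sub_const hA c (f := fun x => (x - c) * g x - 1) (hg1.sub continuous_const)]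
    rw [cfc_congr (g := fun _ => 0) fun x hx => ?_, cfc_const_zero]
    rcases lt_or_ge |x - c| r with hxr | hxr
    · simp [h x hx hxr]
    · have h2 : r ^ 2 ≤ (x - c) ^ 2 := by
        rw [← sq_abs (x - c)]; exact pow_le_pow_left₀ hr.le hxr 2
      have h3 : x - c ≠ 0 := fun h0 => by rw [h0, abs_zero] at hxr; linarith
      simp only [g, max_eq_left h2]
      field_simp
      ring
  have hfin : ((D * cfc g A - 1 : H →L[ℂ] H) : H →ₗ[ℂ] H).HasFiniteRange := by
    have hle : LinearMap.range ((D * cfc g A - 1 : H →L[ℂ] H) : H →ₗ[ℂ] H) ≤ D.ker := by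
      rintro _ ⟨x, rfl⟩
      exact congrArg (fun B : H →L[ℂ] H => B x) hz
    have := Submodule.finiteDimensional_of_le hle
    exact Submodule.fg_iff_finiteDimensional _ |>.mpr this
  refine isFredholm_of_left_right (L := cfc g A) (R := cfc g A) ?_ hfin
  rwa [← cfc_mul_sub_const' hA c hg, cfc_mul_sub_const hA c hg]

/-- If `A - c` is Fredholm, it becomes invertible after adding the projection onto its kernel. -/
theorem isUnit_add_starProjection (hA : IsSelfAdjoint A) {c : ℝ}
    (hF : (A - (c : ℂ) • ContinuousLinearMap.id ℂ H).IsFredholm)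
    [(A - (c : ℂ) • ContinuousLinearMap.id ℂ H).ker.HasOrthogonalProjection] :
    IsUnit (A - (c : ℂ) • ContinuousLinearMap.id ℂ H +
      (A - (c : ℂ) • ContinuousLinearMap.id ℂ H).ker.starProjection) := by
  set D := A - (c : ℂ) • ContinuousLinearMap.id ℂ H with hD
  have hDs : IsSelfAdjoint D := by
    rw [hD, ← cfc_sub_const hA]; exact cfc_predicate _ A
  have hort (x : H) : D x ∈ D.kerᗮ := by
    rw [Submodule.mem_orthogonal]
    intro u hu
    have h := hDs.isSymmetric u x
    change ⟪D u, x⟫_ℂ = ⟪u, D x⟫_ℂ at h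
    rw [← h, show D u = 0 from hu, inner_zero_left]
  have hrange : D.range = D.kerᗮ := by
    have : D.range.HasOrthogonalProjection :=
      have := hF.isClosed_range.completeSpace_coe
      inferInstance
    rw [← Submodule.orthogonal_orthogonal D.range]
    congr 1
    ext x
    rw [Submodule.mem_orthogonal]
    constructor
    · intro h
      change D x = 0
      have h1 := h (D (D x)) ⟨D x, rfl⟩
      have h2 := hDs.isSymmetric (D x) x
      change ⟪D (D x), x⟫_ℂ = ⟪D x, D x⟫_ℂ at h2
      rw [h1] at h2
      exact inner_self_eq_zero.mp h2.symm
    · rintro hx _ ⟨y, rfl⟩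
      have h := hDs.isSymmetric y x
      change ⟪D y, x⟫_ℂ = ⟪y, D x⟫_ℂ at h
      change ⟪D y, x⟫_ℂ = 0
      rw [h, show D x = 0 from hx, inner_zero_right]
  rw [ContinuousLinearMap.isUnit_iff_bijective]
  constructor
  · rw [injective_iff_map_eq_zero]
    intro x hx
    change D x + D.ker.starProjection x = 0 at hx
    have hmem : D x ∈ D.ker := by
      rw [eq_neg_of_add_eq_zero_left hx]
      exact D.ker.neg_mem (Submodule.starProjection_apply_mem _ _)
    have h0 : D x = 0 := by
      have := Submodule.inner_right_of_mem_orthogonal hmem (hort x)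
      exact inner_self_eq_zero.mp this
    rw [h0, zero_add, Submodule.starProjection_eq_self_iff.mpr h0] at hx
    exact hx
  · intro y
    have hy : y - D.ker.starProjection y ∈ D.range := by
      rw [hrange]; exact Submodule.sub_starProjection_mem_orthogonal y
    obtain ⟨x, hx⟩ := hy
    change D x = _ at hx
    refine ⟨x - D.ker.starProjection x + D.ker.starProjection y, ?_⟩
    change D _ + D.ker.starProjection _ = y
    have h1 (w : H) : D (D.ker.starProjection w) = 0 :=
      Submodule.starProjection_apply_mem D.ker w
    have h2 (w : H) : D.ker.starProjection (D.ker.starProjection w) = D.ker.starProjection w :=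
      Submodule.starProjection_eq_self_iff.mpr (Submodule.starProjection_apply_mem _ _)
    simp only [map_add, map_sub, h1, h2, hx]
    abel

theorem acSpectrum_subset_essentialSpectrum (hA : IsSelfAdjoint A) :
    acSpectrum A hA ⊆ essentialSpectrum A := by
  intro z hz
  by_contra hF
  rw [essentialSpectrum, Set.mem_ofPred_eq, not_not] at hF
  -- It suffices to invert `A - z` on the absolutely continuous subspace by the restriction of an
  -- operator that commutes with `A`.
  suffices h : ∃ B : H →L[ℂ] H, Commute A B ∧ ∀ φ ∈ acSubspace A,
      B ((A - z • ContinuousLinearMap.id ℂ H) φ) = φ ∧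
        (A - z • ContinuousLinearMap.id ℂ H) (B φ) = φ by
    obtain ⟨B, hB, hBφ⟩ := h
    let B' := B.restrict (p := acSubspace A) (q := acSubspace A)
      fun φ hφ => apply_mem_acSubspace hA hB hφ
    refine hz ?_
    rw [spectrum.mem_resolventSet_iff, ← IsUnit.neg_iff, neg_sub]
    refine ⟨⟨_, B', ?_, ?_⟩, rfl⟩
    · ext φ
      exact (hBφ φ φ.2).2
    · ext φ
      exact (hBφ φ φ.2).1
  by_cases hzs : z ∈ spectrum ℂ A
  · obtain ⟨c, rfl⟩ : ∃ c : ℝ, z = c := ⟨z.re, hA.mem_spectrum_eq_re hzs⟩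
    have hfin := hF.finite_ker
    set D := A - (c : ℂ) • ContinuousLinearMap.id ℂ H with hD
    set P := D.ker.starProjection with hP
    obtain ⟨E, hE⟩ := isUnit_add_starProjection hA hF
    rw [← hD, ← hP] at hE
    have hDs : IsSelfAdjoint D := by
      rw [hD, ← cfc_sub_const hA]; exact cfc_predicate _ A
    have hDP : D * P = 0 := by
      ext x
      exact Submodule.starProjection_apply_mem D.ker x
    have hPD : P * D = 0 := by
      have h := congrArg star hDP
      rwa [star_mul, star_zero, hDs.star_eq,
        (show star P = P from (isSelfAdjoint_starProjection D.ker))] at h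
    have hAE : Commute A (E : H →L[ℂ] H) := by
      have hDE : Commute D (E : H →L[ℂ] H) := by
        rw [hE]
        refine (Commute.refl D).add_right ?_
        rw [Commute, SemiconjBy, hDP, hPD]
      have hAD : A = D + (c : ℂ) • (1 : H →L[ℂ] H) := by rw [hD]; exact (sub_add_cancel _ _).symm
      rw [hAD]
      exact hDE.add_left ((Commute.one_left _).smul_left _)
    have hB : Commute A (↑E⁻¹ : H →L[ℂ] H) := hAE.units_inv_right
    have hφE (φ : H) (hφ : φ ∈ acSubspace A) : D φ = (E : H →L[ℂ] H) φ := by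
      have h0 : P φ = 0 := by
        rw [hP, Submodule.starProjection_apply_eq_zero_iff, Submodule.mem_orthogonal]
        exact fun ψ hψ => inner_eigenvector_eq_zero hA hψ hφ
      rw [hE, add_apply, h0, add_zero]
    refine ⟨_, hB, fun φ hφ => ⟨?_, ?_⟩⟩
    · rw [hφE φ hφ]
      exact congrArg (fun B : H →L[ℂ] H => B φ) E.inv_mul
    · rw [hφE _ (apply_mem_acSubspace hA hB hφ)]
      exact congrArg (fun B : H →L[ℂ] H => B φ) E.mul_inv
  · rw [spectrum.notMem_iff, ← IsUnit.neg_iff, neg_sub] at hzs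
    obtain ⟨E, hE⟩ := hzs
    have hE' : (E : H →L[ℂ] H) = A - z • ContinuousLinearMap.id ℂ H := hE
    rw [← hE']
    refine ⟨↑E⁻¹, Commute.units_inv_right ?_, fun φ _ => ⟨?_, ?_⟩⟩
    · rw [hE]
      exact (Commute.refl A).sub_right (Algebra.commutes z A).symm
    · exact congrArg (fun B : H →L[ℂ] H => B φ) E.inv_mul
    · exact congrArg (fun B : H →L[ℂ] H => B φ) E.mul_inv

/-- Suppose that eigenspaces are finite-dimensional and that `φ` separates the commutant of `A`
and has a spectral measure that is absolutely continuous off a finite set. Then no point of the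
essential spectrum is isolated in the spectrum, and away from the finite set, bump functions of `A`
applied to `φ` are approximate eigenvectors in the absolutely continuous subspace. -/
theorem essentialSpectrum_subset_acSpectrum (hA : IsSelfAdjoint A)
    (hker : ∀ c : ℝ, FiniteDimensional ℂ (A - (c : ℂ) • ContinuousLinearMap.id ℂ H).ker)
    {φ : H} (hsep : ∀ B : H →L[ℂ] H, Commute A B → B φ = 0 → B = 0) {Z : Set ℝ} (hZ : Z.Finite)
    (hφ : ∀ N : Set ℝ, volume N = 0 → spectralMeasure A φ (N ∩ Zᶜ) = 0) :
    essentialSpectrum A ⊆ acSpectrum A hA := by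
  intro z hz
  obtain ⟨c, rfl⟩ : ∃ c : ℝ, z = c :=
    ⟨z.re, hA.mem_spectrum_eq_re (essentialSpectrum_subset_spectrum A hz)⟩
  intro hu
  rw [spectrum.mem_resolventSet_iff, ← IsUnit.neg_iff, neg_sub] at hu
  obtain ⟨E, hE⟩ := hu
  -- `A - c` is bounded below on the absolutely continuous subspace
  obtain ⟨C, hC, hlow⟩ : ∃ C : ℝ, 0 < C ∧ ∀ χ ∈ acSubspace A,
      ‖χ‖ ≤ C * ‖(A - (c : ℂ) • ContinuousLinearMap.id ℂ H) χ‖ := by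
    refine ⟨‖(↑E⁻¹ : acSubspace A →L[ℂ] acSubspace A)‖ + 1, by positivity, fun χ hχ => ?_⟩
    have h1 : (↑E⁻¹ : acSubspace A →L[ℂ] acSubspace A) ((E : acSubspace A →L[ℂ] acSubspace A)
        ⟨χ, hχ⟩) = ⟨χ, hχ⟩ :=
      congrArg (fun B : acSubspace A →L[ℂ] acSubspace A => B ⟨χ, hχ⟩) E.inv_mul
    have h2 := (↑E⁻¹ : acSubspace A →L[ℂ] acSubspace A).le_opNorm
      ((E : acSubspace A →L[ℂ] acSubspace A) ⟨χ, hχ⟩)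
    rw [h1, hE] at h2
    change ‖χ‖ ≤ _ * ‖(A - (c : ℂ) • ContinuousLinearMap.id ℂ H) χ‖ at h2
    linarith [norm_nonneg ((A - (c : ℂ) • ContinuousLinearMap.id ℂ H) χ)]
  -- a point of the spectrum near `c` that is outside `Z`
  obtain ⟨x, hx, hxZ, hxc⟩ : ∃ x ∈ spectrum ℝ A, x ∉ Z ∧ |x - c| < 1 / (2 * C) := by
    by_contra! hcon
    refine hz ?_
    obtain ⟨r, hr, hrZ⟩ := Metric.mem_nhds_iff.mp
      (((hZ.subset (Set.sdiff_subset (t := {c}))).isClosed.isOpen_compl).mem_nhds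
        (x := c) (by simp))
    refine isFredholm_of_isolated hA (r := min r (1 / (2 * C))) (by positivity) (hker c)
      fun x hx hxc => ?_
    by_contra hne
    rw [lt_min_iff] at hxc
    refine absurd (hcon x hx fun hxZ => ?_) (not_le.mpr hxc.2)
    exact hrZ (show x ∈ Metric.ball c r from hxc.1) ⟨hxZ, hne⟩
  obtain ⟨r, hr, hrZ⟩ := Metric.mem_nhds_iff.mp (hZ.isClosed.isOpen_compl.mem_nhds hxZ)
  set s := min (r / 2) (1 / (8 * C)) with hs
  have hs0 : 0 < s := by positivity
  have hmem : cfc (plateau x s) A φ ∈ acSubspace A := by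
    refine cfc_apply_mem_acSubspace A hφ (continuous_plateau x s) fun y hy => ?_
    refine plateau_eq_zero hs0 ?_
    have h1 : r ≤ |y - x| := by
      by_contra! hlt
      exact hrZ (show y ∈ Metric.ball x r from hlt) hy
    linarith [min_le_left (r / 2) (1 / (8 * C))]
  have hne : cfc (plateau x s) A φ ≠ 0 := by
    intro h0
    have h1 : plateau x s x ∈ spectrum ℝ (cfc (plateau x s) A) := by
      rw [cfc_map_spectrum (plateau x s) A hA (continuous_plateau x s).continuousOn]
      exact ⟨x, hx, rfl⟩
    rw [plateau_eq_one hs0 (by simpa using hs0.le), hsep _ (hA.commute_cfc (Commute.refl A) _).symm h0] at h1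
    have : Nontrivial (H →L[ℂ] H) := by
      rcases subsingleton_or_nontrivial (H →L[ℂ] H) with h | h
      · rw [spectrum.of_subsingleton] at h1; exact h1.elim
      · exact h
    rw [spectrum.zero_eq, Set.mem_singleton_iff] at h1
    exact one_ne_zero h1
  set χ := cfc (plateau x s) A φ with hχ
  have h1 := hlow χ hmem
  have h2 := norm_sub_apply_plateau_le hA (c := x) hs0 φ
  rw [← hχ] at h2
  have h3 : ‖(A - (c : ℂ) • ContinuousLinearMap.id ℂ H) χ‖ ≤ (2 * s + |x - c|) * ‖χ‖ := by
    have e : (A - (c : ℂ) • ContinuousLinearMap.id ℂ H) χ =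
        (A - (x : ℂ) • ContinuousLinearMap.id ℂ H) χ + ((x - c : ℝ) : ℂ) • χ := by
      simp only [sub_apply, smul_apply, ContinuousLinearMap.id_apply, Complex.ofReal_sub, sub_smul]
      abel
    rw [e, add_mul]
    refine (norm_add_le _ _).trans (add_le_add h2 ?_)
    rw [norm_smul, Complex.norm_real, Real.norm_eq_abs]
  have h4 : 0 < ‖χ‖ := norm_pos_iff.mpr hne
  have h5 : C * (2 * s + |x - c|) < 1 := by
    have h6 : C * s ≤ 1 / 8 := by
      calc C * s ≤ C * (1 / (8 * C)) := mul_le_mul_of_nonneg_left (min_le_right _ _) hC.le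
        _ = 1 / 8 := by field_simp
    have h7 : C * |x - c| < 1 / 2 := by
      calc C * |x - c| < C * (1 / (2 * C)) := mul_lt_mul_of_pos_left hxc hC
        _ = 1 / 2 := by field_simp
    nlinarith
  have h8 : ‖χ‖ ≤ C * (2 * s + |x - c|) * ‖χ‖ := by
    rw [mul_assoc]; exact h1.trans (mul_le_mul_of_nonneg_left h3 hC.le)
  nlinarith

end SpectrumComparison

section JacobiOperator

/-! ### The standard basis and the Jacobi operator -/

/-- The standard basis vector `e_n` of `ℓ²(ℕ; ℂ)`. -/
noncomputable def stdBasis (n : ℕ) : Ell2 := lp.single 2 n (1 : ℂ)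

theorem stdBasis_apply (n m : ℕ) : stdBasis n m = if m = n then 1 else 0 := by
  rw [stdBasis, lp.single_apply, Pi.single_apply]

theorem norm_stdBasis (n : ℕ) : ‖stdBasis n‖ = 1 := by
  rw [stdBasis, lp.norm_single (by norm_num), norm_one]

theorem inner_stdBasis_left (n : ℕ) (u : Ell2) : ⟪stdBasis n, u⟫_ℂ = u n := by
  rw [stdBasis, lp.inner_single_left]; simp

theorem orthonormal_stdBasis : Orthonormal ℂ stdBasis := by
  rw [orthonormal_iff_ite]
  intro i j
  rw [inner_stdBasis_left, stdBasis_apply]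

theorem ext_stdBasis {F : Type*} [AddCommGroup F] [Module ℂ F] [TopologicalSpace F] [T2Space F]
    {B D : Ell2 →L[ℂ] F} (h : ∀ n, B (stdBasis n) = D (stdBasis n)) : B = D := by
  refine lp.ext_continuousLinearMap (by norm_num) fun n => ?_
  ext
  exact h n

theorem real_smul_eq (r : ℝ) (u : Ell2) : r • u = (r : ℂ) • u := by
  ext n
  change r • u n = (r : ℂ) • u n
  simp

/-- An operator that annihilates all but finitely many basis vectors has finite rank. -/
theorem hasFiniteRange_of_apply_stdBasis {G : Ell2 →L[ℂ] Ell2} {T : ℕ}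
    (h : ∀ n, T ≤ n → G (stdBasis n) = 0) : (G : Ell2 →ₗ[ℂ] Ell2).HasFiniteRange := by
  have e : G = ∑ n ∈ Finset.range T, (innerSL ℂ (stdBasis n)).smulRight (G (stdBasis n)) := by
    refine ext_stdBasis fun m => ?_
    simp only [sum_apply, ContinuousLinearMap.smulRight_apply, innerSL_apply_apply,
      inner_stdBasis_left, stdBasis_apply, ite_smul, one_smul, zero_smul]
    rw [Finset.sum_ite_eq' (Finset.range T) m fun n => G (stdBasis n)]
    split_ifs with hm
    · rfl
    · exact h m (by simpa using hm)
  have hle : LinearMap.range (G : Ell2 →ₗ[ℂ] Ell2) ≤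
      Submodule.span ℂ ((fun n => G (stdBasis n)) '' (Finset.range T : Set ℕ)) := by
    rintro _ ⟨x, rfl⟩
    change G x ∈ _
    rw [e, sum_apply]
    refine Submodule.sum_mem _ fun n hn => ?_
    rw [← e]
    exact Submodule.smul_mem _ _ (Submodule.subset_span ⟨n, hn, rfl⟩)
  have : FiniteDimensional ℂ (Submodule.span ℂ
      ((fun n => G (stdBasis n)) '' (Finset.range T : Set ℕ))) :=
    FiniteDimensional.span_of_finite ℂ ((Finset.range T).finite_toSet.image _)
  exact (Submodule.fg_iff_finiteDimensional _).mpr (Submodule.finiteDimensional_of_le hle)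

variable {T : ℕ} [NeZero T]

theorem perExt_add_period (c : Fin T → ℝ) (n : ℕ) : perExt c (n + T) = perExt c n := by
  unfold perExt
  congr 1
  ext
  simp [Fin.ofNat]

theorem perExt_pos {c : Fin T → ℝ} (hc : ∀ i, 0 < c i) (n : ℕ) : 0 < perExt c n := hc _

theorem prod_perExt (c : Fin T → ℝ) (n : ℕ) :
    ∏ j ∈ Finset.range T, perExt c (n + j) = ∏ j ∈ Finset.range T, perExt c j := by
  induction n with
  | zero => simp
  | succ n ih =>
    rw [← ih]
    obtain ⟨k, hk⟩ := Nat.exists_eq_succ_of_ne_zero (NeZero.ne T)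
    have h : Finset.range T = Finset.range (k + 1) := by rw [hk]
    rw [h, Finset.prod_range_succ, Finset.prod_range_succ']
    have h1 : n + 1 + k = n + T := by omega
    rw [h1, perExt_add_period, add_zero]
    simp only [add_assoc, add_comm 1]

variable (a b : Fin T → ℝ)

theorem jacobi_stdBasis_zero :
    jacobi a b (stdBasis 0) =
      (perExt b 0 : ℂ) • stdBasis 0 + (perExt a 0 : ℂ) • stdBasis 1 := by
  ext n
  rw [jacobi_apply]
  change _ = (perExt b 0 : ℂ) • stdBasis 0 n + (perExt a 0 : ℂ) • stdBasis 1 n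
  rcases n with _ | _ | n <;> simp [jacobiFun, stdBasis_apply]

theorem jacobi_stdBasis_succ (n : ℕ) :
    jacobi a b (stdBasis (n + 1)) = (perExt a n : ℂ) • stdBasis n +
      (perExt b (n + 1) : ℂ) • stdBasis (n + 1) + (perExt a (n + 1) : ℂ) • stdBasis (n + 2) := by
  ext m
  rw [jacobi_apply]
  change _ = (perExt a n : ℂ) • stdBasis n m +
      (perExt b (n + 1) : ℂ) • stdBasis (n + 1) m + (perExt a (n + 1) : ℂ) • stdBasis (n + 2) m
  rcases m with _ | m
  · simp only [jacobiFun, stdBasis_apply]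
    rcases n with _ | n <;> simp
  · simp only [jacobiFun, stdBasis_apply, smul_eq_mul, mul_ite, mul_one, mul_zero,
      Nat.add_right_cancel_iff]
    have h1 : (m + 2 = n + 1) ↔ (m + 1 = n) := by omega
    simp only [h1]
    by_cases e1 : m = n <;> by_cases e2 : m + 1 = n <;> by_cases e3 : m = n + 1
    all_goals first
      | (exfalso; omega)
      | (subst e1; simp)
      | (subst e2; simp [e3])
      | (subst e3; simp [e2])
      | simp [e1, e2, e3]

open Polynomial

/-- The discriminant as a monic polynomial of degree `T` in the spectral parameter. -/
noncomputable def discPoly : ℝ[X] := discriminant (C ∘ perExt a) (C ∘ perExt b) X T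

/-- The monic polynomial of the first kind of degree `n`. -/
noncomputable def firstPoly (n : ℕ) : ℝ[X] := firstKind (C ∘ perExt a) (C ∘ perExt b) X n

theorem aeval_firstPoly_stdBasis (n : ℕ) :
    aeval (jacobi a b) (firstPoly a b n) (stdBasis 0) =
      ((∏ j ∈ Finset.range n, perExt a j : ℝ) : ℂ) • stdBasis n := by
  induction n using Nat.twoStepInduction with
  | zero => simp [firstPoly, firstKind_zero]
  | one =>
    rw [firstPoly, firstKind_one, Function.comp_apply, map_sub, aeval_X, aeval_C,
      Algebra.algebraMap_eq_smul_one]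
    change jacobi a b (stdBasis 0) - perExt b 0 • stdBasis 0 = _
    rw [jacobi_stdBasis_zero, real_smul_eq]
    simp
  | more n ih1 ih2 =>
    rw [firstPoly, firstKind_add_two, Function.comp_apply, Function.comp_apply, map_sub, map_mul,
      map_mul, map_sub, aeval_X, aeval_C, map_pow, aeval_C, Algebra.algebraMap_eq_smul_one,
      Algebra.algebraMap_eq_smul_one, _root_.smul_pow, one_pow]
    change (jacobi a b (aeval (jacobi a b) (firstPoly a b (n + 1)) (stdBasis 0)) -
      perExt b (n + 1) • (aeval (jacobi a b) (firstPoly a b (n + 1)) (stdBasis 0))) -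
      perExt a n ^ 2 • (aeval (jacobi a b) (firstPoly a b n) (stdBasis 0)) = _
    rw [ih1, ih2, map_smul, jacobi_stdBasis_succ, real_smul_eq, real_smul_eq,
      Finset.prod_range_succ _ (n + 1), Finset.prod_range_succ]
    push_cast
    module

theorem firstPoly_ne_zero (ha : ∀ i, 0 < a i) (n : ℕ) : firstPoly a b n ≠ 0 := by
  intro h
  have h1 := aeval_firstPoly_stdBasis a b n
  rw [h, map_zero, zero_apply, eq_comm, smul_eq_zero, Complex.ofReal_eq_zero] at h1
  rcases h1 with h1 | h1
  · exact (Finset.prod_pos fun j _ => perExt_pos ha j).ne' h1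
  · have := norm_stdBasis n
    rw [h1, norm_zero] at this
    exact zero_ne_one this

/-- The discriminant of the Jacobi operator acts far from the boundary as a multiple of the sum of
the shifts by one period in both directions. -/
theorem aeval_discPoly_stdBasis (ha : ∀ i, 0 < a i) (n : ℕ) :
    aeval (jacobi a b) (discPoly a b) (stdBasis (n + T)) =
      ((∏ j ∈ Finset.range T, perExt a j : ℝ) : ℂ) • (stdBasis (n + T + T) + stdBasis n) := by
  have hC (n : ℕ) : ((∏ j ∈ Finset.range n, perExt a j : ℝ) : ℂ) ≠ 0 :=
    Complex.ofReal_ne_zero.mpr (Finset.prod_pos fun j _ => perExt_pos ha j).ne'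
  have hper (n : ℕ) : ∏ j ∈ Finset.range (n + T), perExt a j =
      (∏ j ∈ Finset.range n, perExt a j) * ∏ j ∈ Finset.range T, perExt a j := by
    rw [Finset.prod_range_add, prod_perExt]
  have h := discriminant_mul_firstKind (a := C ∘ perExt a) (b := C ∘ perExt b) (T := T)
    (fun n => congrArg C (perExt_add_period a n)) (fun n => congrArg C (perExt_add_period b n)) X n
  simp only [Function.comp_apply, ← map_prod, prod_perExt, ← map_pow] at h
  have h1 := congrArg (fun p => aeval (jacobi a b) p (stdBasis 0)) h
  simp only [map_mul, map_add, aeval_C, Algebra.algebraMap_eq_smul_one] at h1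
  change aeval (jacobi a b) (discPoly a b) (aeval (jacobi a b) (firstPoly a b (n + T)) (stdBasis 0))
    = aeval (jacobi a b) (firstPoly a b (n + T + T)) (stdBasis 0) +
      (∏ j ∈ Finset.range T, perExt a j) ^ 2 • (aeval (jacobi a b) (firstPoly a b n) (stdBasis 0))
    at h1
  rw [aeval_firstPoly_stdBasis, aeval_firstPoly_stdBasis, aeval_firstPoly_stdBasis, map_smul,
    real_smul_eq] at h1
  refine smul_right_injective _ (hC (n + T)) ?_
  change _ • _ = _ • _
  rw [h1, hper (n + T), hper n]
  push_cast
  module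

/-- The vector `e_0` is cyclic for the Jacobi operator, so it separates the commutant. -/
theorem eq_zero_of_commute_jacobi (ha : ∀ i, 0 < a i) (B : Ell2 →L[ℂ] Ell2)
    (hB : Commute (jacobi a b) B) (h0 : B (stdBasis 0) = 0) : B = 0 := by
  refine ext_stdBasis fun n => ?_
  have hC : ((∏ j ∈ Finset.range n, perExt a j : ℝ) : ℂ) ≠ 0 :=
    Complex.ofReal_ne_zero.mpr (Finset.prod_pos fun j _ => perExt_pos ha j).ne'
  refine smul_right_injective _ hC ?_
  change _ • _ = _ • _
  have hc : ∀ p : ℝ[X], B * aeval (jacobi a b) p = aeval (jacobi a b) p * B := by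
    intro p
    induction p using Polynomial.induction_on' with
    | add p q hp hq => rw [map_add, mul_add, add_mul, hp, hq]
    | monomial n r =>
      rw [aeval_monomial, ← mul_assoc, ← Algebra.commutes r B, mul_assoc, mul_assoc,
        (hB.pow_left n).eq]
  have h := congrArg (fun D : Ell2 →L[ℂ] Ell2 => D (stdBasis 0)) (hc (firstPoly a b n))
  change B (aeval (jacobi a b) (firstPoly a b n) (stdBasis 0)) =
      aeval (jacobi a b) (firstPoly a b n) (B (stdBasis 0)) at h
  rw [h0, map_zero, aeval_firstPoly_stdBasis, map_smul] at h
  rw [h, zero_apply, smul_zero]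

theorem finiteDimensional_ker_jacobi_sub (ha : ∀ i, 0 < a i) (z : ℂ) :
    FiniteDimensional ℂ (jacobi a b - z • ContinuousLinearMap.id ℂ Ell2).ker := by
  let φ : (jacobi a b - z • ContinuousLinearMap.id ℂ Ell2).ker →ₗ[ℂ] ℂ :=
    { toFun := fun u => (u : Ell2) 0
      map_add' := fun u v => rfl
      map_smul' := fun c u => rfl }
  refine FiniteDimensional.of_injective φ ?_
  rw [injective_iff_map_eq_zero]
  rintro ⟨u, hu⟩ h0
  change u 0 = 0 at h0
  have hrow (n : ℕ) : jacobiFun (perExt a) (perExt b) u n = z * u n := by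
    have h : jacobi a b u - z • u = 0 := hu
    have := congrArg (fun v : Ell2 => v n) (sub_eq_zero.mp h)
    exact this
  have hane (n : ℕ) : (perExt a n : ℂ) ≠ 0 := Complex.ofReal_ne_zero.mpr (perExt_pos ha n).ne'
  have h : ∀ n, u n = 0 ∧ u (n + 1) = 0 := by
    intro n
    induction n with
    | zero =>
      have h1 := hrow 0
      simp only [jacobiFun, h0, mul_zero, zero_add, mul_eq_zero, hane, false_or] at h1
      exact ⟨h0, h1⟩
    | succ n ih =>
      have h1 := hrow (n + 1)
      simp only [jacobiFun, ih.1, ih.2, mul_zero, zero_add, mul_eq_zero, hane, false_or] at h1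
      exact ⟨ih.2, h1⟩
  refine Subtype.ext ?_
  ext n
  exact (h n).1

end JacobiOperator

section EssentialSpectrum

open Polynomial Filter Topology

/-! ### The essential spectrum as the preimage of an interval under the discriminant -/

/-- The isometric shift `e_n ↦ e_{n+k}`. -/
noncomputable def shift (k : ℕ) : Ell2 →ₗᵢ[ℂ] Ell2 :=
  (orthonormal_stdBasis.comp (· + k) (add_left_injective k)).orthogonalFamily.linearIsometry

theorem shift_stdBasis (k n : ℕ) : shift k (stdBasis n) = stdBasis (n + k) := by
  rw [shift, stdBasis, OrthogonalFamily.linearIsometry_apply_single]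
  simp [stdBasis]

theorem adjoint_shift_stdBasis (k n : ℕ) :
    ContinuousLinearMap.adjoint (shift k).toContinuousLinearMap (stdBasis (n + k)) =
      stdBasis n := by
  have h := (ContinuousLinearMap.norm_map_iff_adjoint_comp_self
    (shift k).toContinuousLinearMap).mp (shift k).norm_map
  have h1 := congrArg (fun D : Ell2 →L[ℂ] Ell2 => D (stdBasis n)) h
  change ContinuousLinearMap.adjoint (shift k).toContinuousLinearMap (shift k (stdBasis n)) =
    stdBasis n at h1
  rwa [shift_stdBasis] at h1

theorem tendsto_apply_zero (u : Ell2) : Tendsto (fun n => u n) atTop (𝓝 0) := by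
  rw [tendsto_zero_iff_norm_tendsto_zero]
  simpa using ((memℓp_two_iff _).mp u.2).tendsto_atTop_zero.sqrt

/-- A finite rank operator maps the standard basis, which tends weakly to zero, to a sequence that
tends to zero in norm. -/
theorem tendsto_apply_stdBasis {G : Ell2 →L[ℂ] Ell2}
    (hG : (G : Ell2 →ₗ[ℂ] Ell2).HasFiniteRange) :
    Tendsto (fun n => G (stdBasis n)) atTop (𝓝 0) := by
  have hfin : FiniteDimensional ℂ (LinearMap.range (G : Ell2 →ₗ[ℂ] Ell2)) :=
    (Submodule.fg_iff_finiteDimensional _).mp hG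
  let B := stdOrthonormalBasis ℂ (LinearMap.range (G : Ell2 →ₗ[ℂ] Ell2))
  have e (x : Ell2) : G x = ∑ i, ⟪(B i : Ell2), G x⟫_ℂ • (B i : Ell2) := by
    have h := congrArg Subtype.val (B.sum_repr' ⟨G x, x, rfl⟩)
    simpa using h.symm
  have hlim : Tendsto (fun n => ∑ i, ⟪(B i : Ell2), G (stdBasis n)⟫_ℂ • (B i : Ell2)) atTop
      (𝓝 (∑ i, (0 : ℂ) • (B i : Ell2))) := by
    refine tendsto_finsetSum _ fun i _ => Tendsto.smul_const ?_ _
    have h1 := (Complex.continuous_conj.tendsto _).comp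
      (tendsto_apply_zero (ContinuousLinearMap.adjoint G (B i)))
    rw [map_zero] at h1
    refine h1.congr fun n => ?_
    rw [Function.comp_apply, ← inner_stdBasis_left, inner_conj_symm,
      ContinuousLinearMap.adjoint_inner_left]
  simp only [zero_smul, Finset.sum_const_zero] at hlim
  exact hlim.congr fun n => (e _).symm

variable {T : ℕ} [NeZero T] (a b : Fin T → ℝ)

/-- Where the discriminant takes a value outside the interval, `J - z` is Fredholm: the discriminant of `J` is a finite
rank perturbation of a multiple of `S + S*`, whose spectrum lies in `[-2, 2]`. -/
theorem isFredholm_jacobi_sub (ha : ∀ i, 0 < a i) (z : ℂ)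
    (hz : ¬ ∃ c : ℝ, |c| ≤ 2 * ∏ j ∈ Finset.range T, perExt a j ∧
      aeval z (discPoly a b) = (c : ℂ)) :
    (jacobi a b - z • ContinuousLinearMap.id ℂ Ell2).IsFredholm := by
  set P := ∏ j ∈ Finset.range T, perExt a j with hP
  have hP0 : 0 < P := Finset.prod_pos fun j _ => perExt_pos ha j
  have hPC : (P : ℂ) ≠ 0 := Complex.ofReal_ne_zero.mpr hP0.ne'
  set w := aeval z (discPoly a b) with hw
  set S := (shift T).toContinuousLinearMap with hS
  set D₀ := S + ContinuousLinearMap.adjoint S with hD₀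
  have hself : IsSelfAdjoint D₀ := by
    rw [hD₀, ← ContinuousLinearMap.star_eq_adjoint]
    exact IsSelfAdjoint.add_star_self S
  have hnorm : ‖D₀‖ ≤ 2 := by
    have h1 : ‖S‖ ≤ 1 := (shift T).norm_toContinuousLinearMap_le
    have h2 : ‖ContinuousLinearMap.adjoint S‖ = ‖S‖ :=
      ContinuousLinearMap.adjoint.norm_map S
    calc ‖D₀‖ ≤ ‖S‖ + ‖ContinuousLinearMap.adjoint S‖ := norm_add_le _ _
      _ ≤ 2 := by rw [h2]; linarith
  have hspec : w / P ∉ spectrum ℂ D₀ := by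
    intro hmem
    have h1 := hself.mem_spectrum_eq_re hmem
    have h2 := (spectrum.norm_le_norm_mul_of_mem hmem)
    refine hz ⟨P * (w / P).re, ?_, ?_⟩
    · have h3 : |(w / P).re| ≤ 2 := by
        refine (Complex.abs_re_le_norm _).trans (h2.trans ?_)
        have h4 : ‖(1 : Ell2 →L[ℂ] Ell2)‖ ≤ 1 := ContinuousLinearMap.norm_id_le
        calc ‖D₀‖ * ‖(1 : Ell2 →L[ℂ] Ell2)‖ ≤ 2 * 1 := by gcongr
          _ = 2 := by norm_num
      rw [abs_mul, abs_of_pos hP0, mul_comm]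
      gcongr
    · rw [Complex.ofReal_mul, ← h1]
      field_simp
  rw [spectrum.notMem_iff] at hspec
  have hE : IsUnit ((P : ℂ) • D₀ - algebraMap ℂ (Ell2 →L[ℂ] Ell2) w) := by
    have h1 : (P : ℂ) • D₀ - algebraMap ℂ (Ell2 →L[ℂ] Ell2) w =
        algebraMap ℂ (Ell2 →L[ℂ] Ell2) (-P) * (algebraMap ℂ (Ell2 →L[ℂ] Ell2) (w / P) - D₀) := by
      rw [mul_sub, ← map_mul, Algebra.smul_def, map_neg, neg_mul, neg_mul, mul_div_cancel₀ _ hPC,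
        map_neg]
      abel
    rw [h1]
    exact ((IsUnit.mk0 _ (neg_ne_zero.mpr hPC)).map _).mul hspec
  obtain ⟨E, hE⟩ := hE
  -- division of `Q(X) - Q(z)` by `X - z`
  obtain ⟨p, hp⟩ := X_sub_C_dvd_sub_C_eval (a := z)
    (p := (discPoly a b).map (algebraMap ℝ ℂ))
  have hev : ((discPoly a b).map (algebraMap ℝ ℂ)).eval z = w := by
    rw [eval_map_algebraMap]
  rw [hev] at hp
  have hD : aeval (jacobi a b) (X - C z : ℂ[X]) =
      jacobi a b - z • ContinuousLinearMap.id ℂ Ell2 := by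
    rw [map_sub, aeval_X, aeval_C, Algebra.algebraMap_eq_smul_one]
    rfl
  have hprod : (jacobi a b - z • ContinuousLinearMap.id ℂ Ell2) * aeval (jacobi a b) p =
      aeval (jacobi a b) (discPoly a b) - algebraMap ℂ (Ell2 →L[ℂ] Ell2) w := by
    rw [← hD, ← map_mul, ← hp, map_sub, aeval_C, aeval_map_algebraMap]
  have hcomm : Commute (jacobi a b - z • ContinuousLinearMap.id ℂ Ell2) (aeval (jacobi a b) p) := by
    rw [← hD]
    exact (Commute.all (X - C z) p).map (aeval (jacobi a b))
  refine isFredholm_of_commute hcomm E ?_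
  rw [hprod, hE, sub_sub_sub_cancel_right]
  refine hasFiniteRange_of_apply_stdBasis (T := T) fun n hn => ?_
  obtain ⟨m, rfl⟩ := Nat.exists_eq_add_of_le' hn
  have h1 : D₀ (stdBasis (m + T)) = stdBasis (m + T + T) + stdBasis m := by
    change shift T (stdBasis (m + T)) + ContinuousLinearMap.adjoint S (stdBasis (m + T)) = _
    rw [shift_stdBasis, hS, adjoint_shift_stdBasis]
  rw [sub_apply, smul_apply, h1, aeval_discPoly_stdBasis a b ha, sub_self]

theorem aeval_discPoly (z : ℂ) :
    aeval z (discPoly a b) =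
      discriminant (fun n => (perExt a n : ℂ)) (fun n => (perExt b n : ℂ)) z T := by
  have h := map_discriminant (aeval z : ℝ[X] →ₐ[ℝ] ℂ).toRingHom (C ∘ perExt a) (C ∘ perExt b) X T
  refine h.trans ?_
  congr 1
  · funext n; simp
  · funext n; simp
  · simp

/-- If the discriminant takes a value in the interval, the recursion has a Floquet solution of
constant modulus along the period. -/
theorem exists_floquet (ha : ∀ i, 0 < a i) {z : ℂ} {c : ℝ}
    (hc : |c| ≤ 2 * ∏ j ∈ Finset.range T, perExt a j) (hz : aeval z (discPoly a b) = (c : ℂ)) :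
    ∃ w : ℕ → ℂ, (∀ n, (perExt a n : ℂ) * w n + perExt b (n + 1) * w (n + 1) +
        perExt a (n + 1) * w (n + 2) = z * w (n + 1)) ∧
      (∀ n, ‖w (n + T)‖ = ‖w n‖) ∧ ∃ n, w n ≠ 0 := by
  set P := ∏ j ∈ Finset.range T, perExt a j with hP
  have hP0 : 0 < P := Finset.prod_pos fun j _ => perExt_pos ha j
  set α : ℕ → ℂ := fun n => (perExt a n : ℂ) with hα
  set β : ℕ → ℂ := fun n => (perExt b n : ℂ) with hβ
  have hαne (n : ℕ) : α n ≠ 0 := Complex.ofReal_ne_zero.mpr (perExt_pos ha n).ne'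
  have hαper (n : ℕ) : α (n + T) = α n := by simp only [hα, perExt_add_period]
  have hβper (n : ℕ) : β (n + T) = β n := by simp only [hβ, perExt_add_period]
  set W := transferProd α β z 0 T with hW
  have htr : W.trace = c := by rw [← hz, aeval_discPoly]; rfl
  have hdet : W.det = (P : ℂ) ^ 2 := by
    rw [hW, det_transferProd, hP]
    simp [hα]
  -- an eigenvalue `P ξ` of the transfer matrix over a period, with `ξ` of modulus one
  set t := c / (2 * P) with ht
  have ht1 : |t| ≤ 1 := by
    rw [ht, abs_div, abs_of_pos (by linarith : 0 < 2 * P)]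
    exact (div_le_one (by linarith)).mpr hc
  have hct : c = 2 * P * t := by rw [ht]; field_simp
  have ht2 : 0 ≤ 1 - t ^ 2 := by
    have := (sq_le_one_iff_abs_le_one t).mpr ht1
    linarith
  set s := √(1 - t ^ 2) with hs
  have hs2 : (s : ℂ) ^ 2 = 1 - (t : ℂ) ^ 2 := by
    rw [← Complex.ofReal_pow, hs, Real.sq_sqrt ht2]; push_cast; ring
  set ξ : ℂ := t + s * Complex.I with hξ
  have hξn : ‖ξ‖ = 1 := by
    rw [hξ, Complex.norm_add_mul_I, hs, Real.sq_sqrt ht2]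
    simp
  have hξeq : ξ ^ 2 - 2 * t * ξ + 1 = 0 := by
    have : ξ ^ 2 - 2 * t * ξ + 1 = 1 - (t : ℂ) ^ 2 - (s : ℂ) ^ 2 + (s : ℂ) ^ 2 * (Complex.I ^ 2 + 1) := by
      rw [hξ]; ring
    rw [this, hs2, Complex.I_sq]; ring
  obtain ⟨V, hV0, hV⟩ := Matrix.exists_mulVec_eq_zero_iff.mpr
    (show (W - ((P : ℂ) * ξ) • (1 : Matrix (Fin 2) (Fin 2) ℂ)).det = 0 by
      have h1 : (W - ((P : ℂ) * ξ) • (1 : Matrix (Fin 2) (Fin 2) ℂ)).det =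
          W.det - P * ξ * W.trace + (P * ξ) ^ 2 := by
        simp [Matrix.det_fin_two, Matrix.trace_fin_two]; ring
      rw [h1, hdet, htr, hct]
      push_cast
      linear_combination (P : ℂ) ^ 2 * hξeq)
  have hWV : W.mulVec V = ((P : ℂ) * ξ) • V := by
    rw [Matrix.sub_mulVec, Matrix.smul_mulVec, Matrix.one_mulVec] at hV
    exact sub_eq_zero.mp hV
  have hprod (n : ℕ) : ∏ j ∈ Finset.range n, α j ≠ 0 := Finset.prod_ne_zero_iff.mpr fun j _ => hαne j
  let v : ℕ → Fin 2 → ℂ := fun n => (∏ j ∈ Finset.range n, α j)⁻¹ •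
    (transferProd α β z 0 n).mulVec V
  have hstep (n : ℕ) : α n • v (n + 1) = (transferMatrix (α n) (β n) z).mulVec (v n) := by
    simp only [v]
    rw [Matrix.mulVec_smul, Matrix.mulVec_mulVec, transferProd, Finset.prod_range_succ, zero_add,
      smul_smul, mul_inv, mul_comm, mul_assoc, inv_mul_cancel₀ (hαne n), mul_one]
  have h0 (n : ℕ) : α n * v (n + 1) 0 = (z - β n) * v n 0 - v n 1 := by
    have := congrFun (hstep n) 0
    simpa [transferMatrix, Matrix.mulVec, dotProduct, Fin.sum_univ_two, sub_eq_add_neg] using this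
  have h1 (n : ℕ) : v (n + 1) 1 = α n * v n 0 := by
    have := congrFun (hstep n) 1
    simp only [transferMatrix, Matrix.mulVec, dotProduct, Fin.sum_univ_two, Pi.smul_apply,
      smul_eq_mul, Matrix.of_apply, Matrix.cons_val_one, Matrix.cons_val_zero,
      Matrix.cons_val_fin_one, zero_mul, add_zero] at this
    refine mul_left_cancel₀ (hαne n) ?_
    rw [this]; ring
  have hper (n : ℕ) : v (n + T) = ξ • v n := by
    have e1 : transferProd α β z 0 (n + T) = transferProd α β z 0 n * W := by
      rw [add_comm, transferProd_add, transferProd_shift hαper hβper]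
    have e2 : ∏ j ∈ Finset.range (n + T), α j = (∏ j ∈ Finset.range n, α j) * P := by
      rw [Finset.prod_range_add]
      congr 1
      simp only [hα, ← Complex.ofReal_prod, prod_perExt, hP]
    simp only [v]
    rw [e1, e2, ← Matrix.mulVec_mulVec, hWV, Matrix.mulVec_smul, smul_smul, smul_smul, mul_inv]
    have hPC : (P : ℂ) ≠ 0 := Complex.ofReal_ne_zero.mpr hP0.ne'
    congr 1
    field_simp
  refine ⟨fun n => v n 0, fun n => ?_, fun n => ?_, ?_⟩
  · have e1 := h0 (n + 1)
    rw [h1] at e1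
    change α n * v n 0 + β (n + 1) * v (n + 1) 0 + α (n + 1) * v (n + 2) 0 = _
    linear_combination e1
  · change ‖v (n + T) 0‖ = _
    rw [hper, Pi.smul_apply, smul_eq_mul, norm_mul, hξn, one_mul]
  · by_contra! hall
    refine hV0 ?_
    have hv0 : v 0 = V := by
      simp only [v, transferProd, Finset.range_zero, Finset.prod_empty, inv_one, one_smul,
        Matrix.one_mulVec]
    have e1 := h0 0
    change ∀ n, v n 0 = 0 at hall
    rw [hall, hall, mul_zero, mul_zero, zero_sub, eq_comm, neg_eq_zero] at e1
    funext i
    fin_cases i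
    · rw [← hv0]; exact hall 0
    · rw [← hv0]; exact e1

/-- Cutting a formal solution off to a window leaves only boundary terms. -/
theorem jacobi_sub_window {z : ℂ} {w : ℕ → ℂ}
    (hw : ∀ n, (perExt a n : ℂ) * w n + perExt b (n + 1) * w (n + 1) +
        perExt a (n + 1) * w (n + 2) = z * w (n + 1)) (k N : ℕ) :
    (jacobi a b - z • ContinuousLinearMap.id ℂ Ell2)
        (∑ n ∈ Finset.range N, w (k + n + 1) • stdBasis (k + n + 1)) =
      ((perExt a k : ℂ) * w (k + 1)) • stdBasis k - ((perExt a k : ℂ) * w k) • stdBasis (k + 1) -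
        (((perExt a (k + N) : ℂ) * w (k + N + 1)) • stdBasis (k + N) -
          ((perExt a (k + N) : ℂ) * w (k + N)) • stdBasis (k + N + 1)) := by
  induction N with
  | zero => simp
  | succ N ih =>
    have h := hw (k + N)
    have h' : (perExt a (k + N) : ℂ) * w (k + N) =
        z * w (k + N + 1) - perExt b (k + N + 1) * w (k + N + 1) -
          perExt a (k + N + 1) * w (k + N + 2) := by
      linear_combination h
    rw [Finset.sum_range_succ, map_add, ih, map_smul, sub_apply, smul_apply,
      ContinuousLinearMap.id_apply, jacobi_stdBasis_succ, h', ← add_assoc]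
    module

theorem norm_sum_stdBasis_sq (c : ℕ → ℂ) (k N : ℕ) :
    ‖∑ n ∈ Finset.range N, c (k + n + 1) • stdBasis (k + n + 1)‖ ^ 2 =
      ∑ n ∈ Finset.range N, ‖c (k + n + 1)‖ ^ 2 := by
  have ho : Orthonormal ℂ fun n => stdBasis (k + n + 1) :=
    orthonormal_stdBasis.comp (fun n => k + n + 1) fun x y h => by
      simpa using h
  rw [← inner_self_eq_norm_sq (𝕜 := ℂ), ho.inner_sum]
  simp only [map_sum, RCLike.conj_mul, ← RCLike.ofReal_pow, RCLike.ofReal_re]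

/-- Floquet solutions cut off to long windows far from the boundary contradict the Fredholm
property: their norms are unbounded, the norms of their images under `J - z` are bounded, and they
tend weakly to zero as the window moves away. -/
theorem not_isFredholm_jacobi_sub (ha : ∀ i, 0 < a i) {z : ℂ} {c : ℝ}
    (hc : |c| ≤ 2 * ∏ j ∈ Finset.range T, perExt a j) (hz : aeval z (discPoly a b) = (c : ℂ)) :
    ¬ (jacobi a b - z • ContinuousLinearMap.id ℂ Ell2).IsFredholm := by
  intro hF
  obtain ⟨w, hw, hper, n₀, hn₀⟩ := exists_floquet a b ha hc hz
  have hperk (n k : ℕ) : ‖w (n + k * T)‖ = ‖w n‖ := by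
    induction k with
    | zero => simp
    | succ k ih => rw [← ih, Nat.succ_mul, ← add_assoc, hper]
  obtain ⟨M, hM⟩ : ∃ M : ℝ, ∀ n, ‖w n‖ ≤ M := by
    obtain ⟨M, hM⟩ := ((Finset.range T).image fun n => ‖w n‖).bddAbove
    refine ⟨M, fun n => ?_⟩
    have h := hperk (n % T) (n / T)
    rw [Nat.mod_add_div'] at h
    rw [h]
    exact hM (Finset.mem_coe.mpr (Finset.mem_image_of_mem _
      (Finset.mem_range.mpr (Nat.mod_lt _ (NeZero.pos T)))))
  have hM0 : 0 ≤ M := (norm_nonneg _).trans (hM 0)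
  obtain ⟨Ca, hCa⟩ := exists_bound_perExt a
  have hCa0 : 0 ≤ Ca := (abs_nonneg _).trans (hCa 0)
  set D := jacobi a b - z • ContinuousLinearMap.id ℂ Ell2 with hD
  obtain ⟨B, hB⟩ := hF.exists_isQuasiInverse
  set K := B * D - 1 with hK
  have hKfin : (K : Ell2 →ₗ[ℂ] Ell2).HasFiniteRange :=
    LinearMap.FiniteRangeSetoid.equiv_iff_hasFiniteRange.mp hB.1
  set u : ℕ → ℕ → Ell2 := fun k N =>
    ∑ n ∈ Finset.range N, w (k * T + n + 1) • stdBasis (k * T + n + 1) with hu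
  have hnorm (k N : ℕ) : ‖u k N‖ = ‖u 0 N‖ := by
    rw [← sq_eq_sq₀ (norm_nonneg _) (norm_nonneg _), hu]
    simp only [norm_sum_stdBasis_sq]
    refine Finset.sum_congr rfl fun n _ => ?_
    rw [zero_mul, zero_add, ← hperk (n + 1) k]
    congr 3
    ring
  have hDu (k N : ℕ) : ‖D (u k N)‖ ≤ 4 * (Ca * M) := by
    have hterm (i j l : ℕ) : ‖((perExt a i : ℂ) * w j) • stdBasis l‖ ≤ Ca * M := by
      rw [norm_smul, norm_stdBasis, mul_one, norm_mul, Complex.norm_real, Real.norm_eq_abs]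
      exact mul_le_mul (hCa i) (hM j) (norm_nonneg _) hCa0
    rw [hu, hD]
    simp only [jacobi_sub_window a b hw]
    refine (norm_sub_le _ _).trans ((add_le_add (norm_sub_le _ _) (norm_sub_le _ _)).trans ?_)
    linarith [hterm (k * T) (k * T + 1) (k * T), hterm (k * T) (k * T) (k * T + 1),
      hterm (k * T + N) (k * T + N + 1) (k * T + N), hterm (k * T + N) (k * T + N) (k * T + N + 1)]
  -- windows far away are hardly seen by the finite rank operator `K`
  have hKu (N : ℕ) : Tendsto (fun k => ‖K (u k N)‖) atTop (𝓝 0) := by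
    have h1 : Tendsto (fun k => ∑ n ∈ Finset.range N, M * ‖K (stdBasis (k * T + n + 1))‖) atTop
        (𝓝 (∑ n ∈ Finset.range N, M * 0)) := by
      refine tendsto_finsetSum _ fun n _ => Tendsto.const_mul _ ?_
      have h2 := (tendsto_apply_stdBasis hKfin).norm
      rw [norm_zero] at h2
      refine h2.comp (tendsto_atTop_mono (fun k => ?_) tendsto_id)
      have : k * 1 ≤ k * T := Nat.mul_le_mul_left k (NeZero.pos T)
      simp only [id]; omega
    simp only [mul_zero, Finset.sum_const_zero] at h1
    refine squeeze_zero (fun _ => norm_nonneg _) (fun k => ?_) h1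
    rw [hu]
    simp only [map_sum, map_smul]
    refine (norm_sum_le _ _).trans (Finset.sum_le_sum fun n _ => ?_)
    rw [norm_smul]
    exact mul_le_mul_of_nonneg_right (hM _) (norm_nonneg _)
  have hbound (N : ℕ) : ‖u 0 N‖ ≤ ‖B‖ * (4 * (Ca * M)) := by
    have h1 : ∀ k, ‖u 0 N‖ ≤ ‖B‖ * (4 * (Ca * M)) + ‖K (u k N)‖ := by
      intro k
      have e : u k N = B (D (u k N)) - K (u k N) := by
        rw [hK]; simp
      rw [← hnorm k N]
      calc ‖u k N‖ = ‖B (D (u k N)) - K (u k N)‖ := congrArg _ e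
        _ ≤ ‖B (D (u k N))‖ + ‖K (u k N)‖ := norm_sub_le _ _
        _ ≤ _ := by
          gcongr
          exact (B.le_opNorm _).trans (mul_le_mul_of_nonneg_left (hDu k N) (norm_nonneg _))
    have h2 := (hKu N).const_add (‖B‖ * (4 * (Ca * M)))
    rw [add_zero] at h2
    exact ge_of_tendsto h2 (Eventually.of_forall h1)
  have hsum : Summable fun n => ‖w (n + 1)‖ ^ 2 := by
    refine summable_of_sum_range_le (c := (‖B‖ * (4 * (Ca * M))) ^ 2) (fun n => sq_nonneg _)
      fun N => ?_
    have h1 := pow_le_pow_left₀ (norm_nonneg _) (hbound N) 2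
    simp only [hu] at h1
    rw [norm_sum_stdBasis_sq] at h1
    simpa only [zero_mul, zero_add] using h1
  have hlim := (tendsto_add_atTop_iff_nat (f := fun n => ‖w n‖ ^ 2) 1).mp hsum.tendsto_atTop_zero
  have hconst : Tendsto (fun k : ℕ => ‖w (n₀ + k * T)‖ ^ 2) atTop (𝓝 0) := by
    refine hlim.comp (tendsto_atTop_mono (fun k => ?_) tendsto_id)
    have : k * 1 ≤ k * T := Nat.mul_le_mul_left k (NeZero.pos T)
    simp only [id]; omega
  simp only [hperk] at hconst
  have h0 := tendsto_nhds_unique hconst tendsto_const_nhds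
  exact hn₀ (norm_eq_zero.mp (pow_eq_zero_iff two_ne_zero |>.mp h0.symm))

theorem mem_essentialSpectrum_jacobi_iff (ha : ∀ i, 0 < a i) (z : ℂ) :
    z ∈ essentialSpectrum (jacobi a b) ↔
      ∃ c : ℝ, |c| ≤ 2 * ∏ j ∈ Finset.range T, perExt a j ∧ aeval z (discPoly a b) = (c : ℂ) := by
  constructor
  · intro h
    by_contra hz
    exact h (isFredholm_jacobi_sub a b ha z hz)
  · rintro ⟨c, hc, hz⟩
    exact not_isFredholm_jacobi_sub a b ha hc hz

end EssentialSpectrum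

section MFunction

open Polynomial Filter Topology

/-! ### The Weyl function and absolute continuity -/

/-- The spectral measure of a ball of radius `r` around `c` is controlled by the diagonal resolvent
matrix element at `c + i r`. -/
theorem spectralMeasure_closedBall_le_resolvent {H : Type*} [NormedAddCommGroup H]
    [InnerProductSpace ℂ H] [CompleteSpace H] {A : H →L[ℂ] H} (hA : IsSelfAdjoint A) {c r : ℝ}
    (hr : 0 < r) {φ u : H}
    (hu : (A - (c + r * Complex.I : ℂ) • ContinuousLinearMap.id ℂ H) u = φ) :
    spectralMeasure A φ (Metric.closedBall c r) ≤ ENNReal.ofReal (9 * ‖⟪φ, u⟫_ℂ‖ * r) := by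
  set D := A - (c : ℂ) • ContinuousLinearMap.id ℂ H with hD
  have hDs : IsSelfAdjoint D := by
    rw [hD, ← cfc_sub_const hA]; exact cfc_predicate _ A
  have hφ : φ = D u - (r * Complex.I : ℂ) • u := by
    rw [← hu, hD]
    simp only [sub_apply, smul_apply, ContinuousLinearMap.id_apply]
    module
  -- `r ‖u‖² = |Im ⟨φ, u⟩|`
  have him : r * ‖u‖ ^ 2 ≤ ‖⟪φ, u⟫_ℂ‖ := by
    have h1 : (⟪u, D u⟫_ℂ).im = 0 := by
      have h := hDs.isSymmetric u u
      change ⟪D u, u⟫_ℂ = ⟪u, D u⟫_ℂ at h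
      rw [← inner_conj_symm] at h
      exact Complex.conj_eq_iff_im.mp h
    have h2 : (⟪u, φ⟫_ℂ).im = -(r * ‖u‖ ^ 2) := by
      rw [hφ, inner_sub_right, inner_smul_right, Complex.sub_im, h1, inner_self_eq_norm_sq_to_K]
      simp [← Complex.ofReal_pow]
    rw [norm_inner_symm]
    calc r * ‖u‖ ^ 2 = |(⟪u, φ⟫_ℂ).im| := by rw [h2, abs_neg, abs_of_nonneg (by positivity)]
      _ ≤ _ := Complex.abs_im_le_norm _
  have hpl : ‖cfc (plateau c r) A u‖ ≤ ‖u‖ := norm_plateau_apply_le hA c r u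
  have hnorm : ‖cfc (plateau c r) A φ‖ ≤ 3 * r * ‖u‖ := by
    have h1 : cfc (plateau c r) A (D u) = D (cfc (plateau c r) A u) := by
      have h := (cfc_mul_sub_const' hA c (continuous_plateau c r)).symm.trans
        (cfc_mul_sub_const hA c (continuous_plateau c r))
      exact congrArg (fun B : H →L[ℂ] H => B u) h
    rw [hφ, map_sub, map_smul, h1]
    have h2 := norm_sub_apply_plateau_le hA (c := c) hr u
    have h3 : ‖(r * Complex.I : ℂ) • cfc (plateau c r) A u‖ ≤ r * ‖u‖ := by
      rw [norm_smul, norm_mul, Complex.norm_I, mul_one, Complex.norm_real, Real.norm_of_nonneg hr.le]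
      gcongr
    refine (norm_sub_le _ _).trans ?_
    have h4 : 2 * r * ‖cfc (plateau c r) A u‖ ≤ 2 * r * ‖u‖ := by gcongr
    linarith
  refine (spectralMeasure_closedBall_le A φ hr).trans (ENNReal.ofReal_le_ofReal ?_)
  calc ‖cfc (plateau c r) A φ‖ ^ 2 ≤ (3 * r * ‖u‖) ^ 2 := by gcongr
    _ = 9 * (r * ‖u‖ ^ 2) * r := by ring
    _ ≤ _ := by gcongr

/-- Roots of quadratic equations whose coefficients converge stay bounded, if the leading
coefficient has a nonzero limit. -/
theorem eventually_norm_le_of_quadratic {ι : Type*} {l : Filter ι} {p q s m : ι → ℂ} {p₀ q₀ s₀ : ℂ}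
    (hp : Tendsto p l (𝓝 p₀)) (hq : Tendsto q l (𝓝 q₀)) (hs : Tendsto s l (𝓝 s₀)) (hp₀ : p₀ ≠ 0)
    (h : ∀ᶠ i in l, p i * m i ^ 2 + q i * m i + s i = 0) : ∃ C : ℝ, ∀ᶠ i in l, ‖m i‖ ≤ C := by
  have hlim : Tendsto (fun i => 1 + (‖q i‖ + ‖s i‖) / ‖p i‖) l
      (𝓝 (1 + (‖q₀‖ + ‖s₀‖) / ‖p₀‖)) :=
    ((hq.norm.add hs.norm).div hp.norm (norm_ne_zero_iff.mpr hp₀)).const_add 1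
  refine ⟨1 + (‖q₀‖ + ‖s₀‖) / ‖p₀‖ + 1, ?_⟩
  filter_upwards [hlim.eventually_lt_const (lt_add_one _), h, hp.eventually_ne hp₀]
    with i hi hm hpi
  refine le_trans ?_ hi.le
  have hpos : 0 < ‖p i‖ := norm_pos_iff.mpr hpi
  rcases le_total ‖m i‖ 1 with h1 | h1
  · have : 0 ≤ (‖q i‖ + ‖s i‖) / ‖p i‖ := by positivity
    linarith
  · have h2 : ‖p i‖ * ‖m i‖ ^ 2 ≤ ‖q i‖ * ‖m i‖ + ‖s i‖ := by
      have e : p i * m i ^ 2 = -(q i * m i + s i) := by linear_combination hm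
      rw [← norm_pow, ← norm_mul, e, norm_neg, ← norm_mul]
      exact norm_add_le _ _
    have h3 : ‖m i‖ ≤ (‖q i‖ + ‖s i‖) / ‖p i‖ := by
      rw [le_div_iff₀ hpos]
      refine le_of_mul_le_mul_right (a := ‖m i‖) ?_ (by linarith)
      have h4 : ‖s i‖ ≤ ‖s i‖ * ‖m i‖ := le_mul_of_one_le_right (norm_nonneg _) h1
      calc ‖m i‖ * ‖p i‖ * ‖m i‖ = ‖p i‖ * ‖m i‖ ^ 2 := by ring
        _ ≤ _ := h2
        _ ≤ (‖q i‖ + ‖s i‖) * ‖m i‖ := by rw [add_mul]; linarith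
    linarith

theorem continuous_transferProd (α β : ℕ → ℂ) (n k : ℕ) :
    Continuous fun z : ℂ => transferProd α β z n k := by
  induction k with
  | zero => exact continuous_const
  | succ k ih =>
    refine Continuous.matrix_mul ?_ ih
    refine continuous_matrix fun i j => ?_
    fin_cases i <;> fin_cases j <;> simp [transferMatrix] <;> fun_prop

variable {T : ℕ} [NeZero T] (a b : Fin T → ℝ)

/-- The value `m = u_0` of the resolvent `u = (J - z)⁻¹ e_0` satisfies a quadratic equation with
polynomial coefficients: the shift of `u` by one period is a second square summable solution of the
same recursion, so that the Wronskian of the two, which is constant and tends to zero, vanishes. -/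
theorem resolvent_quadratic (ha : ∀ i, 0 < a i) {z : ℂ} {u : Ell2}
    (hu : (jacobi a b - z • ContinuousLinearMap.id ℂ Ell2) u = stdBasis 0)
    {W : Matrix (Fin 2) (Fin 2) ℂ}
    (hW : W = transferProd (fun n => (perExt a n : ℂ)) (fun n => (perExt b n : ℂ)) z 0 T) :
    W 1 0 * u 0 ^ 2 + (W 0 0 - W 1 1) * u 0 + -W 0 1 = 0 := by
  set α : ℕ → ℂ := fun n => (perExt a n : ℂ) with hα
  set β : ℕ → ℂ := fun n => (perExt b n : ℂ) with hβ
  have hαne (n : ℕ) : α n ≠ 0 := Complex.ofReal_ne_zero.mpr (perExt_pos ha n).ne'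
  have hαper (n : ℕ) : α (n + T) = α n := by simp only [hα, perExt_add_period]
  have hβper (n : ℕ) : β (n + T) = β n := by simp only [hβ, perExt_add_period]
  have hrow (n : ℕ) : jacobiFun (perExt a) (perExt b) u n - z * u n = stdBasis 0 n :=
    congrArg (fun v : Ell2 => v n) hu
  -- the auxiliary component of the state, with the source term as its initial value
  let t : ℕ → ℂ := fun n => n.casesOn (-1) fun k => α k * u k
  have ht0 : t 0 = -1 := rfl
  have ht (n : ℕ) : t (n + 1) = α n * u n := rfl
  have hrec (n : ℕ) : α n * u (n + 1) = (z - β n) * u n - t n := by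
    cases n with
    | zero =>
      have h := hrow 0
      simp only [jacobiFun, stdBasis_apply, if_true] at h
      rw [ht0]
      linear_combination h
    | succ n =>
      have h := hrow (n + 1)
      simp only [jacobiFun, stdBasis_apply, if_neg (Nat.succ_ne_zero n)] at h
      rw [ht]
      linear_combination h
  have hstate (n : ℕ) : (∏ j ∈ Finset.range n, α j) * u n =
        transferProd α β z 0 n 0 0 * u 0 - transferProd α β z 0 n 0 1 ∧
      (∏ j ∈ Finset.range n, α j) * t n =
        transferProd α β z 0 n 1 0 * u 0 - transferProd α β z 0 n 1 1 := by
    induction n with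
    | zero => simp [transferProd, ht0]
    | succ n ih =>
      have e0 (j : Fin 2) : transferProd α β z 0 (n + 1) 0 j =
          (z - β n) * transferProd α β z 0 n 0 j - transferProd α β z 0 n 1 j := by
        rw [transferProd, Matrix.mul_apply, Fin.sum_univ_two]
        simp [transferMatrix, sub_eq_add_neg]
      have e1 (j : Fin 2) : transferProd α β z 0 (n + 1) 1 j =
          α n ^ 2 * transferProd α β z 0 n 0 j := by
        rw [transferProd, Matrix.mul_apply, Fin.sum_univ_two]
        simp [transferMatrix]
      rw [Finset.prod_range_succ, e0, e0, e1, e1, ht]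
      constructor
      · linear_combination (∏ j ∈ Finset.range n, α j) * hrec n + (z - β n) * ih.1 - ih.2
      · linear_combination α n ^ 2 * ih.1
  have htper (n : ℕ) : t (n + 1 + T) = α n * u (n + T) := by
    rw [add_right_comm, ht, hαper]
  have hwr (n : ℕ) : u n * t (n + T) - t n * u (n + T) = u 0 * t T - t 0 * u T := by
    induction n with
    | zero => simp
    | succ n ih =>
      have h1 := hrec n
      have h2 := hrec (n + T)
      rw [hαper, hβper] at h2
      rw [← ih, htper, ht, add_right_comm n 1 T]
      linear_combination u (n + T) * h1 - u n * h2
  have hlim : Tendsto (fun n => u (n + 1) * t (n + 1 + T) - t (n + 1) * u (n + 1 + T)) atTop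
      (𝓝 0) := by
    obtain ⟨C, hC⟩ := exists_bound_perExt a
    have hu0 := (tendsto_apply_zero u).norm
    rw [norm_zero] at hu0
    have e1 := hu0.comp (tendsto_add_atTop_nat 1)
    have e2 := hu0.comp (tendsto_add_atTop_nat T)
    have e3 := hu0.comp (tendsto_add_atTop_nat (1 + T))
    have hl := ((e1.mul e2).add (hu0.mul e3)).const_mul C
    simp only [mul_zero, add_zero] at hl
    refine squeeze_zero_norm (fun n => ?_) hl
    rw [htper, ht]
    have e : u (n + 1) * (α n * u (n + T)) - α n * u n * u (n + 1 + T) =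
        α n * (u (n + 1) * u (n + T) - u n * u (n + 1 + T)) := by ring
    rw [e, norm_mul]
    refine mul_le_mul ?_ ((norm_sub_le _ _).trans_eq ?_) (norm_nonneg _)
      ((abs_nonneg _).trans (hC n))
    · rw [Complex.norm_real]; exact hC n
    · simp only [norm_mul, Function.comp_apply, add_assoc]
  simp only [hwr] at hlim
  have h0 := tendsto_nhds_unique tendsto_const_nhds hlim
  obtain ⟨s1, s2⟩ := hstate T
  rw [← hW] at s1 s2
  rw [ht0] at h0
  linear_combination (∏ j ∈ Finset.range T, α j) * h0 - u 0 * s2 - s1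

/-- The spectral measure of `e_0` is absolutely continuous off the zeros of a polynomial. -/
theorem spectralMeasure_stdBasis_inter (ha : ∀ i, 0 < a i) {N : Set ℝ} (hN : volume N = 0) :
    spectralMeasure (jacobi a b) (stdBasis 0)
      (N ∩ {x | (firstPoly a b (T - 1)).IsRoot x}ᶜ) = 0 := by
  refine measure_inter_eq_zero_of_closedBall_le _ hN fun x hx => ?_
  have hsa := isSelfAdjoint_jacobi a b
  -- the resolvent exists off the real axis
  have hres (r : ℝ) (hr : 0 < r) : ∃ u : Ell2,
      (jacobi a b - (x + r * Complex.I : ℂ) • ContinuousLinearMap.id ℂ Ell2) u = stdBasis 0 := by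
    have hz : (x + r * Complex.I : ℂ) ∉ spectrum ℂ (jacobi a b) := by
      intro h
      have h1 := congrArg Complex.im (hsa.mem_spectrum_eq_re h)
      simp at h1
      exact hr.ne' h1
    rw [spectrum.notMem_iff, ← IsUnit.neg_iff, neg_sub] at hz
    obtain ⟨E, hE⟩ := hz
    have hE' : (E : Ell2 →L[ℂ] Ell2) =
      jacobi a b - (x + r * Complex.I : ℂ) • ContinuousLinearMap.id ℂ Ell2 := hE
    refine ⟨(↑E⁻¹ : Ell2 →L[ℂ] Ell2) (stdBasis 0), ?_⟩
    rw [← hE']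
    exact congrArg (fun B : Ell2 →L[ℂ] Ell2 => B (stdBasis 0)) E.mul_inv
  choose! u hu using hres
  set α : ℕ → ℂ := fun n => (perExt a n : ℂ) with hα
  set β : ℕ → ℂ := fun n => (perExt b n : ℂ) with hβ
  have hcont : Tendsto (fun r : ℝ => transferProd α β (x + r * Complex.I) 0 T) (𝓝[>] 0)
      (𝓝 (transferProd α β x 0 T)) := by
    have h : Continuous fun r : ℝ => transferProd α β (x + r * Complex.I) 0 T :=
      (continuous_transferProd α β 0 T).comp (by fun_prop)
    have := h.tendsto 0
    simp only [Complex.ofReal_zero, zero_mul, add_zero] at this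
    exact this.mono_left nhdsWithin_le_nhds
  have hentry (i j : Fin 2) := tendsto_pi_nhds.mp (tendsto_pi_nhds.mp hcont i) j
  have hne : transferProd α β x 0 T 1 0 ≠ 0 := by
    obtain ⟨k, hk⟩ := Nat.exists_eq_succ_of_ne_zero (NeZero.ne T)
    have hfirst : firstKind α β (x : ℂ) (T - 1) = ((firstPoly a b (T - 1)).eval x : ℝ) := by
      have h := congrFun (congrFun (map_transferProd
        (aeval (x : ℂ) : ℝ[X] →ₐ[ℝ] ℂ).toRingHom (C ∘ perExt a) (C ∘ perExt b) X 0 (T - 1)) 0) 0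
      have e1 : ((aeval (x : ℂ) : ℝ[X] →ₐ[ℝ] ℂ).toRingHom) ∘ C ∘ perExt a = α := by
        funext n; simp [hα]
      have e2 : ((aeval (x : ℂ) : ℝ[X] →ₐ[ℝ] ℂ).toRingHom) ∘ C ∘ perExt b = β := by
        funext n; simp [hβ]
      have e3 : ((aeval (x : ℂ) : ℝ[X] →ₐ[ℝ] ℂ).toRingHom) X = x := by simp
      rw [e1, e2, e3] at h
      refine h.symm.trans ?_
      change aeval (x : ℂ) (firstPoly a b (T - 1)) = _
      exact aeval_algebraMap_apply ℂ x _
    have hT : transferProd α β x 0 T 1 0 = α k ^ 2 * firstKind α β x (T - 1) := by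
      rw [hk, Nat.succ_sub_one]
      exact transferProd_one_zero α β (x : ℂ) k
    rw [hT, hfirst]
    refine mul_ne_zero (pow_ne_zero _ ?_) (Complex.ofReal_ne_zero.mpr hx)
    exact Complex.ofReal_ne_zero.mpr (perExt_pos ha k).ne'
  obtain ⟨C, hC⟩ := eventually_norm_le_of_quadratic (m := fun r => u r 0) (hentry 1 0)
    ((hentry 0 0).sub (hentry 1 1)) (hentry 0 1).neg hne
    (eventually_of_mem self_mem_nhdsWithin fun r hr =>
      resolvent_quadratic a b ha (hu r hr) rfl)
  refine ⟨9 * C, ?_⟩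
  filter_upwards [hC, self_mem_nhdsWithin] with r hr hr0
  have hr0' : 0 < r := hr0
  refine (spectralMeasure_closedBall_le_resolvent hsa hr0' (hu r hr0)).trans
    (ENNReal.ofReal_le_ofReal ?_)
  rw [inner_stdBasis_left]
  gcongr

theorem essentialSpectrum_jacobi_eq_acSpectrum (ha : ∀ i, 0 < a i) :
    essentialSpectrum (jacobi a b) = acSpectrum (jacobi a b) (isSelfAdjoint_jacobi a b) := by
  refine Set.Subset.antisymm ?_ (acSpectrum_subset_essentialSpectrum _)
  exact essentialSpectrum_subset_acSpectrum _ (fun c => finiteDimensional_ker_jacobi_sub a b ha c)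
    (fun B => eq_zero_of_commute_jacobi a b ha B)
    (finite_setOfPred_isRoot (firstPoly_ne_zero a b ha (T - 1)))
    fun N hN => spectralMeasure_stdBasis_inter a b ha hN

end MFunction

section Generic

open Polynomial

/-! ### Band structure for generic parameters -/

/-- A closed set meeting every line through some fixed point in a countable set is a null set: for
almost every ratio, the image of the set under the homothety about that point is null. -/
theorem addHaar_eq_zero_of_countable_lines {V : Type*} [NormedAddCommGroup V] [NormedSpace ℝ V]
    [FiniteDimensional ℝ V] [MeasurableSpace V] [BorelSpace V] [SecondCountableTopology V]
    (μ : Measure V) [μ.IsAddHaarMeasure] [SFinite μ] {E : Set V} (hE : IsClosed E) (x₀ : V)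
    (h : ∀ v : V, {t : ℝ | x₀ + t • v ∈ E}.Countable) : μ E = 0 := by
  let S : Set (V × ℝ) := {p | x₀ + p.2 • p.1 ∈ E}
  have hS : MeasurableSet S := (hE.preimage (by fun_prop)).measurableSet
  have h1 : (μ.prod volume) S = 0 := by
    rw [Measure.measure_prod_null hS]
    exact Filter.Eventually.of_forall fun v => (h v).measure_zero _
  rw [Measure.prod_apply_symm hS, lintegral_eq_zero_iff (measurable_measure_prodMk_right hS)] at h1
  have h2 : ∀ᵐ t : ℝ, t ≠ 0 := by
    rw [ae_iff]
    simp
  obtain ⟨t, ht, ht0⟩ := (h1.and h2).exists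
  have e : (fun v => (v, t)) ⁻¹' S = (fun v => t • v) ⁻¹' ((fun v => x₀ + v) ⁻¹' E) := rfl
  replace ht : μ ((fun v => (v, t)) ⁻¹' S) = 0 := ht
  rw [e, Measure.addHaar_preimage_smul μ ht0, measure_preimage_add, mul_eq_zero] at ht
  refine ht.resolve_left ?_
  rw [ENNReal.ofReal_eq_zero, not_le, abs_pos]
  exact inv_ne_zero (pow_ne_zero _ ht0)

theorem volume_zeros_mvPolynomial {σ τ : Type*} [Fintype σ] [Fintype τ]
    (G : MvPolynomial (σ ⊕ τ) ℝ) {p₀ : (σ → ℝ) × (τ → ℝ)}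
    (hG : MvPolynomial.eval (Sum.elim p₀.1 p₀.2) G ≠ 0) :
    IsClosed {p : (σ → ℝ) × (τ → ℝ) | MvPolynomial.eval (Sum.elim p.1 p.2) G = 0} ∧
      volume {p : (σ → ℝ) × (τ → ℝ) | MvPolynomial.eval (Sum.elim p.1 p.2) G = 0} = 0 := by
  have hc : Continuous fun p : (σ → ℝ) × (τ → ℝ) => MvPolynomial.eval (Sum.elim p.1 p.2) G := by
    refine (MvPolynomial.continuous_eval G).comp (continuous_pi fun i => ?_)
    cases i <;> simp <;> fun_prop
  have hcl : IsClosed {p : (σ → ℝ) × (τ → ℝ) | MvPolynomial.eval (Sum.elim p.1 p.2) G = 0} :=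
    isClosed_eq hc continuous_const
  refine ⟨hcl, ?_⟩
  have hH : (volume : Measure ((σ → ℝ) × (τ → ℝ))).IsAddHaarMeasure :=
    Measure.prod.instIsAddHaarMeasure _ _
  refine addHaar_eq_zero_of_countable_lines _ hcl p₀ fun v => ?_
  -- along a line, `G` is a polynomial in one variable
  let g : ℝ[X] := MvPolynomial.aeval
    (fun i => C (Sum.elim p₀.1 p₀.2 i) + X * C (Sum.elim v.1 v.2 i)) G
  have hg (t : ℝ) : g.eval t =
      MvPolynomial.eval (Sum.elim (p₀ + t • v).1 (p₀ + t • v).2) G := by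
    change evalRingHom t g = _
    rw [MvPolynomial.map_aeval]
    have e1 : (evalRingHom t).comp (algebraMap ℝ ℝ[X]) = RingHom.id ℝ := by
      ext; simp
    rw [e1, MvPolynomial.eval]
    congr 2
    funext i
    cases i <;> simp <;> ring
  have hg0 : g ≠ 0 := by
    intro h0
    have := hg 0
    rw [h0, eval_zero, zero_smul, add_zero] at this
    exact hG this.symm
  refine (finite_setOfPred_isRoot hg0).countable.mono fun t ht => ?_
  exact (hg t).trans ht

/-- A monic polynomial with `2 T` distinct real roots is nonpositive exactly on `T` disjoint
intervals. -/
theorem isUnionOfDistinctRealIntervals_of_splits {T : ℕ} {f : ℝ[X]} (hm : f.Monic)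
    (hd : f.natDegree = T * 2) (hs : f.Splits) (hsep : f.Separable) :
    IsUnionOfDistinctRealIntervals T (Complex.ofReal '' {x | f.eval x ≤ 0}) := by
  have hnd := nodup_roots hsep
  have hcard : f.roots.toFinset.card = T * 2 := by
    rw [Multiset.toFinset_card_of_nodup hnd, splits_iff_card_roots.mp hs, hd]
  let e := f.roots.toFinset.orderEmbOfFin hcard
  have heval (x : ℝ) : f.eval x =
      ∏ i : Fin T, (x - e (finProdFinEquiv (i, 0))) * (x - e (finProdFinEquiv (i, 1))) := by
    have h1 : f.eval x = ∏ r ∈ f.roots.toFinset, (x - r) := by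
      conv_lhs => rw [hs.eq_prod_roots, hm.leadingCoeff, C_1, one_mul]
      rw [eval_multiset_prod, Multiset.map_map, Finset.prod, Multiset.toFinset_val,
        hnd.dedup]
      simp
    have h2 : f.roots.toFinset = Finset.univ.map e.toEmbedding :=
      (Finset.map_orderEmbOfFin_univ _ _).symm
    rw [h1, h2, Finset.prod_map, ← finProdFinEquiv.prod_comp, Fintype.prod_prod_type]
    simp only [Fin.prod_univ_two]
    rfl
  have hlt (i : Fin T) : e (finProdFinEquiv (i, 0)) < e (finProdFinEquiv (i, 1)) := by
    refine e.strictMono ?_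
    rw [Fin.lt_def]
    simp [finProdFinEquiv]
  have hsep (i j : Fin T) (hij : i < j) :
      e (finProdFinEquiv (i, 1)) < e (finProdFinEquiv (j, 0)) := by
    refine e.strictMono ?_
    rw [Fin.lt_def] at hij ⊢
    simp only [finProdFinEquiv, Equiv.coe_fn_mk, Fin.val_one, Fin.val_zero]
    omega
  refine ⟨_, _, hlt, hsep, ?_⟩
  congr 1
  ext x
  rw [Set.mem_ofPred_eq, heval, Set.mem_iUnion]
  set α := fun i => e (finProdFinEquiv (i, 0)) with hα
  set β := fun i => e (finProdFinEquiv (i, 1)) with hβ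
  have hmem (i : Fin T) : x ∈ Set.Icc (α i) (β i) ↔ (x - α i) * (x - β i) ≤ 0 := by
    have := hlt i
    rw [mul_nonpos_iff, Set.mem_Icc]
    constructor
    · rintro ⟨h1, h2⟩
      exact Or.inl ⟨by linarith, by linarith⟩
    · rintro (⟨h1, h2⟩ | ⟨h1, h2⟩)
      · exact ⟨by linarith, by linarith⟩
      · have : α i < β i := hlt i
        exact absurd this (by linarith)
  constructor
  · intro h
    by_contra! hcon
    refine absurd h (not_le.mpr (Finset.prod_pos fun i _ => ?_))
    have := hcon i
    rw [hmem, not_le] at this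
    exact this
  · rintro ⟨i, hi⟩
    rw [← Finset.mul_prod_erase _ _ (Finset.mem_univ i)]
    refine mul_nonpos_of_nonpos_of_nonneg ((hmem i).mp hi) (Finset.prod_nonneg fun j hj => ?_)
    by_contra! hneg
    have hj' := (hmem j).mpr hneg.le
    rcases lt_trichotomy i j with hij | hij | hij
    · have : β i < α j := hsep i j hij
      linarith [hi.2, hj'.1]
    · exact (Finset.ne_of_mem_erase hj) hij.symm
    · have : β j < α i := hsep j i hij
      linarith [hi.1, hj'.2]

variable {T : ℕ} [NeZero T]

/-- The discriminant as a polynomial over the ring of polynomials in the parameters, minus `k` times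
the product of the off-diagonal parameters. -/
noncomputable def genericPoly (T : ℕ) [NeZero T] (k : ℝ) :
    (MvPolynomial (Fin T ⊕ Fin T) ℝ)[X] :=
  discriminant (C ∘ fun n => (MvPolynomial.X (Sum.inl (Fin.ofNat T n)) : MvPolynomial (Fin T ⊕ Fin T) ℝ))
    (C ∘ fun n => (MvPolynomial.X (Sum.inr (Fin.ofNat T n)) : MvPolynomial (Fin T ⊕ Fin T) ℝ)) X T -
  C (MvPolynomial.C k * ∏ j ∈ Finset.range T, MvPolynomial.X (Sum.inl (Fin.ofNat T j)))

/-- The resultant of the generic band edge polynomial and its derivative, a polynomial in the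
parameters. -/
noncomputable def edgeResultant (T : ℕ) [NeZero T] (k : ℝ) : MvPolynomial (Fin T ⊕ Fin T) ℝ :=
  resultant (genericPoly T k) (derivative (genericPoly T k)) T (T - 1)

/-- The polynomial whose zeros are the points where the discriminant takes the value
`k a_0 ⋯ a_{T-1}`. -/
noncomputable def edgePoly (a b : Fin T → ℝ) (k : ℝ) : ℝ[X] :=
  discPoly a b - C (k * ∏ j ∈ Finset.range T, perExt a j)

theorem map_genericPoly (a b : Fin T → ℝ) (k : ℝ) :
    (genericPoly T k).map (MvPolynomial.eval (Sum.elim a b)) = edgePoly a b k := by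
  rw [genericPoly, edgePoly, Polynomial.map_sub, discPoly, ← coe_mapRingHom, map_discriminant]
  congr 1
  · congr 1
    · funext n; simp [perExt]
    · funext n; simp [perExt]
    · simp
  · rw [coe_mapRingHom, map_C]
    simp only [map_mul, map_prod, MvPolynomial.eval_C, MvPolynomial.eval_X, Sum.elim_inl]
    rfl

theorem edgePoly_monic (a b : Fin T → ℝ) (k : ℝ) :
    (edgePoly a b k).Monic ∧ (edgePoly a b k).natDegree = T := by
  obtain ⟨h1, h2⟩ := discriminant_monic (perExt a) (perExt b) T
  change (discPoly a b).Monic at h1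
  change (discPoly a b).natDegree = T at h2
  refine ⟨?_, ?_⟩
  · refine h1.sub_of_left (degree_C_le.trans_lt ?_)
    rw [degree_eq_natDegree h1.ne_zero, h2]
    exact_mod_cast NeZero.pos T
  · rw [edgePoly, natDegree_sub_C, h2]

theorem eval_edgeResultant_ne_zero_iff (a b : Fin T → ℝ) (k : ℝ) :
    MvPolynomial.eval (Sum.elim a b) (edgeResultant T k) ≠ 0 ↔ (edgePoly a b k).Separable := by
  obtain ⟨h1, h2⟩ := edgePoly_monic a b k
  have h3 : (derivative (edgePoly a b k)).natDegree = T - 1 := by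
    rw [natDegree_derivative, h2]
  rw [edgeResultant, ← resultant_map_map, ← derivative_map, map_genericPoly]
  have h4 : (edgePoly a b k).resultant (derivative (edgePoly a b k)) T (T - 1) =
      (edgePoly a b k).resultant (derivative (edgePoly a b k)) := by
    rw [h2, h3]
  rw [h4, Ne, resultant_eq_zero_iff, Polynomial.Separable]
  have := h1.ne_zero
  tauto

/-- With vanishing off-diagonal and distinct diagonal parameters the discriminant has simple
zeros, so the resultants are not identically zero. -/
theorem separable_edgePoly_zero (k : ℝ) :
    (edgePoly (0 : Fin T → ℝ) (fun i => (i : ℝ)) k).Separable := by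
  have h0 : perExt (0 : Fin T → ℝ) = 0 := rfl
  have h1 : ∏ j ∈ Finset.range T, perExt (0 : Fin T → ℝ) j = 0 :=
    Finset.prod_eq_zero (Finset.mem_range.mpr (NeZero.pos T)) rfl
  have h2 : (C : ℝ →+* ℝ[X]) ∘ perExt (0 : Fin T → ℝ) = 0 := by
    funext n; simp [h0]
  rw [edgePoly, h1, mul_zero, C_0, sub_zero, discPoly, h2, discriminant_zero]
  simp only [Function.comp_apply]
  rw [separable_prod_X_sub_C_iff']
  intro x hx y hy hxy
  have e (n : ℕ) (hn : n ∈ Finset.range T) : perExt (fun i : Fin T => (i : ℝ)) n = n := by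
    rw [perExt, Fin.val_ofNat, Nat.mod_eq_of_lt (Finset.mem_range.mp hn)]
  rw [e x hx, e y hy] at hxy
  exact_mod_cast hxy

theorem isUnionOfDistinctRealIntervals_essentialSpectrum {a b : Fin T → ℝ} (ha : ∀ i, 0 < a i)
    (h₁ : (edgePoly a b 2).Separable) (h₂ : (edgePoly a b (-2)).Separable) :
    IsUnionOfDistinctRealIntervals T (essentialSpectrum (jacobi a b)) := by
  set P := ∏ j ∈ Finset.range T, perExt a j with hP
  have hP0 : 0 < P := Finset.prod_pos fun j _ => perExt_pos ha j
  have hreal {z : ℂ} (hz : z ∈ essentialSpectrum (jacobi a b)) : z = (z.re : ℂ) :=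
    (isSelfAdjoint_jacobi a b).mem_spectrum_eq_re (essentialSpectrum_subset_spectrum _ hz)
  obtain ⟨m1, d1⟩ := edgePoly_monic a b 2
  obtain ⟨m2, d2⟩ := edgePoly_monic a b (-2)
  have hcop : IsCoprime (edgePoly a b 2) (edgePoly a b (-2)) := by
    have hu : edgePoly a b (-2) - edgePoly a b 2 = C (4 * P) := by
      rw [edgePoly, edgePoly, sub_sub_sub_cancel_left, ← C_sub]
      congr 1
      ring
    refine ⟨-C (4 * P)⁻¹, C (4 * P)⁻¹, ?_⟩
    have : -C (4 * P)⁻¹ * edgePoly a b 2 + C (4 * P)⁻¹ * edgePoly a b (-2) =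
        C (4 * P)⁻¹ * (edgePoly a b (-2) - edgePoly a b 2) := by ring
    rw [this, hu, ← C_mul, inv_mul_cancel₀ (by positivity), C_1]
  have hev (k x : ℝ) : (edgePoly a b k).eval x = (discPoly a b).eval x - k * P := by
    rw [edgePoly, eval_sub, eval_C]
  -- zeros of the band edge polynomials lie in the essential spectrum, hence are real
  have hsplit (k : ℝ) (hk : |k| ≤ 2) : (edgePoly a b k).Splits := by
    refine Splits.of_splits_map (algebraMap ℝ ℂ) (IsAlgClosed.splits _) fun z hz => ?_
    have hz' := isRoot_of_mem_roots hz
    rw [IsRoot, eval_map_algebraMap, edgePoly, map_sub, aeval_C, sub_eq_zero] at hz'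
    have hmem : z ∈ essentialSpectrum (jacobi a b) := by
      rw [mem_essentialSpectrum_jacobi_iff a b ha]
      refine ⟨k * P, ?_, hz'⟩
      rw [abs_mul, abs_of_pos hP0]
      gcongr
    exact ⟨z.re, (hreal hmem).symm⟩
  have hset : essentialSpectrum (jacobi a b) =
      Complex.ofReal '' {x | (edgePoly a b 2 * edgePoly a b (-2)).eval x ≤ 0} := by
    have hx (x : ℝ) : (x : ℂ) ∈ essentialSpectrum (jacobi a b) ↔
        (edgePoly a b 2 * edgePoly a b (-2)).eval x ≤ 0 := by
      have e1 : aeval (x : ℂ) (discPoly a b) = ((discPoly a b).eval x : ℝ) :=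
        aeval_algebraMap_apply ℂ x _
      have e2 : (edgePoly a b 2 * edgePoly a b (-2)).eval x =
          (discPoly a b).eval x ^ 2 - (2 * P) ^ 2 := by
        rw [eval_mul, hev, hev]; ring
      rw [mem_essentialSpectrum_jacobi_iff a b ha, e1, e2, sub_nonpos,
        sq_le_sq, abs_of_pos (by positivity : 0 < 2 * P)]
      constructor
      · rintro ⟨c, hc, h⟩
        rw [Complex.ofReal_inj.mp h]
        exact hc
      · exact fun h => ⟨_, h, rfl⟩
    ext z
    constructor
    · intro hz
      refine ⟨z.re, ?_, (hreal hz).symm⟩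
      rw [Set.mem_ofPred_eq, ← hx, ← hreal hz]
      exact hz
    · rintro ⟨x, hx', rfl⟩
      exact (hx x).mpr hx'
  rw [hset]
  refine isUnionOfDistinctRealIntervals_of_splits (m1.mul m2) ?_ ?_ (h₁.mul h₂ hcop)
  · rw [m1.natDegree_mul m2, d1, d2, mul_two]
  · exact (hsplit 2 (by norm_num)).mul (hsplit (-2) (by norm_num))

end Generic

end PeriodicJacobi

theorem mainTheorem6 (T : ℕ) [NeZero T] :
    (∃ U : Set ((Fin T → ℝ) × (Fin T → ℝ)), IsOpen U ∧ U ⊆ PeriodicJacobi.parameterSpace T ∧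
      PeriodicJacobi.parameterSpace T ⊆ closure U ∧
      volume (PeriodicJacobi.parameterSpace T \ U) = 0 ∧
      ∀ p ∈ U, PeriodicJacobi.IsUnionOfDistinctRealIntervals T
        (PeriodicJacobi.essentialSpectrum (PeriodicJacobi.jacobi p.1 p.2))) ∧
    ∀ p ∈ PeriodicJacobi.parameterSpace T,
      PeriodicJacobi.essentialSpectrum (PeriodicJacobi.jacobi p.1 p.2) =
        PeriodicJacobi.acSpectrum (PeriodicJacobi.jacobi p.1 p.2)
          (PeriodicJacobi.isSelfAdjoint_jacobi p.1 p.2) := by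
  refine ⟨?_, fun p hp => PeriodicJacobi.essentialSpectrum_jacobi_eq_acSpectrum p.1 p.2 hp⟩
  set G := PeriodicJacobi.edgeResultant T 2 * PeriodicJacobi.edgeResultant T (-2) with hG
  set E := {p : (Fin T → ℝ) × (Fin T → ℝ) | MvPolynomial.eval (Sum.elim p.1 p.2) G = 0} with hE
  have hG0 : MvPolynomial.eval (Sum.elim (0 : Fin T → ℝ) fun i : Fin T => (i : ℝ)) G ≠ 0 := by
    rw [hG, map_mul]
    exact mul_ne_zero
      ((PeriodicJacobi.eval_edgeResultant_ne_zero_iff _ _ _).mpr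
        (PeriodicJacobi.separable_edgePoly_zero 2))
      ((PeriodicJacobi.eval_edgeResultant_ne_zero_iff _ _ _).mpr
        (PeriodicJacobi.separable_edgePoly_zero (-2)))
  obtain ⟨hcl, hnull⟩ := PeriodicJacobi.volume_zeros_mvPolynomial G
    (p₀ := (0, fun i : Fin T => (i : ℝ))) hG0
  have hopen : IsOpen (PeriodicJacobi.parameterSpace T) := by
    have : PeriodicJacobi.parameterSpace T =
        ⋂ i, {p : (Fin T → ℝ) × (Fin T → ℝ) | 0 < p.1 i} := by
      ext p; simp [PeriodicJacobi.parameterSpace]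
    rw [this]
    exact isOpen_iInter_of_finite fun i => isOpen_lt continuous_const (by fun_prop)
  have hdiff : PeriodicJacobi.parameterSpace T \ (PeriodicJacobi.parameterSpace T \ E) ⊆ E := by
    rintro p ⟨hp, hpE⟩
    by_contra h
    exact hpE ⟨hp, h⟩
  refine ⟨PeriodicJacobi.parameterSpace T \ E, hopen.sdiff hcl, Set.sdiff_subset, ?_,
    measure_mono_null hdiff hnull, fun p hp => ?_⟩
  · intro p hp
    by_contra hpc
    -- an open set of parameters avoiding the good ones would be null
    set O := PeriodicJacobi.parameterSpace T \
      closure (PeriodicJacobi.parameterSpace T \ E) with hO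
    have hO0 : volume O = 0 :=
      measure_mono_null (fun q hq => hdiff ⟨hq.1, fun h => hq.2 (subset_closure h)⟩) hnull
    have hOe := ((hopen.sdiff isClosed_closure).measure_eq_zero_iff volume).mp hO0
    exact (Set.eq_empty_iff_forall_notMem.mp hOe) p ⟨hp, hpc⟩
  · have h : MvPolynomial.eval (Sum.elim p.1 p.2) G ≠ 0 := hp.2
    rw [hG, map_mul] at h
    exact PeriodicJacobi.isUnionOfDistinctRealIntervals_essentialSpectrum hp.1
      ((PeriodicJacobi.eval_edgeResultant_ne_zero_iff _ _ _).mp (left_ne_zero_of_mul h))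
      ((PeriodicJacobi.eval_edgeResultant_ne_zero_iff _ _ _).mp (right_ne_zero_of_mul h))
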